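/- Let $\lambda>0$, $\beta>2$, $\sigma^2>0$, $l\ge 0$ and let $s\ge 1$ be an integer. Base stations (BSs) are located at the points $X_1,X_2,\ldots$ (numbered in an arbitrary order) of a homogeneous Poisson point process of intensity $\lambda$ on $\mathbb{R}^2$. Let $H_{i,t}$ ($i\ge 1$, $t\ge 0$) be i.i.d. exponential random variables with mean $1$, independent of $(X_i)_i$. A user (UE) moves at constant speed along the segment from the origin $o=(0,0)$ to $(l,0)$ in $s$ units of time, so that at time $t=0,\ldots,s-1$ it is at $\boldsymbol{u}_t=(lt/s,0)$. In the time-based handover (HO) skipping scenario the UE stays attached during this whole movement period to the BS nearest to its starting point, whose index $b_o$ satisfies $\|X_{b_o}\|\le\|X_j\|$ for all $j$ (almost surely it is unique). The amount of data it receives at time $t$ is $$\log\Bigl(1+\frac{H_{b_o,t}\,\|X_{b_o}-\boldsymbol{u}_t\|^{-\beta}}{\sigma^2+I_t}\Bigr),\qquad I_t=\sum_{j\ne b_o}\frac{H_{j,t}}{\|X_j-\boldsymbol{u}_t\|^{\beta}},$$ where the sum $I_t$ converges almost surely. Let $D_2(s,l,\lambda,\beta)$ be the expectation of the total amount of data received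 at the times $t=0,\ldots,s-1$; it is finite, and $$D_2(s,l,\lambda,\beta)=\sum_{t=0}^{s-1}\tau_2\Bigl(\frac{lt}{s},\lambda,\beta\Bigr),$$ where $$\tau_2(u,\lambda,\beta)=\lambda\int_0^{2\pi}\!\!\int_0^\infty\!\!\int_0^\infty r\,e^{-\lambda\pi r^2-\sigma^2 w_{u,r,\theta}^{\,\beta}\,z}\,\frac{\rho_2(z,r,\theta\mid u,\lambda,\beta)}{1+z}\,\mathrm{d}z\,\mathrm{d}r\,\mathrm{d}\theta,$$ $$\rho_2(z,r,\theta\mid u,\lambda,\beta)=\exp\Bigl(-\lambda\int_0^{2\pi}\!\!\int_r^\infty\Bigl\{1+\frac1z\Bigl(\frac{w_{u,v,\varphi}}{w_{u,r,\theta}}\Bigr)^{\beta}\Bigr\}^{-1}v\,\mathrm{d}v\,\mathrm{d}\varphi\Bigr),$$ $$w_{u,r,\theta}=\sqrt{u^2+r^2-2ur\cos\theta}.$$ For each $u=lt/s$ with $0\le t<s$, the triple integral converges, and the double integral in $\rho_2$ converges for all $z,r>0$ and all $\theta$ with $w_{u,r,\theta}>0$. -/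

import Mathlib

open MeasureTheory ProbabilityTheory Set

noncomputable section

namespace HandoverSkipping

/-- The Euclidean plane, with its Euclidean norm and Lebesgue measure. -/
abbrev Plane : Type := EuclideanSpace ℝ (Fin 2)

/-- Number of points of the numbered configuration `x` lying in `B`, counted with multiplicity. -/
def pointCount (x : ℕ → Plane) (B : Set Plane) : ℕ∞ := {i : ℕ | x i ∈ B}.encard

/-- The random points `X 0, X 1, …` (numbered in an arbitrary order) form a homogeneous Poisson
point process of intensity `lam` on the plane: the number of points in a Borel set of finite area
is Poisson with mean `lam` times the area, and the numbers of points in pairwise disjoint Borel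
sets are independent. -/
structure IsHomogeneousPPP {Ω : Type*} [MeasurableSpace Ω] (P : Measure Ω) (lam : ℝ)
    (X : ℕ → Ω → Plane) : Prop where
  measurable : ∀ i, Measurable (X i)
  count_law : ∀ B : Set Plane, MeasurableSet B → volume B ≠ ⊤ →
    HasLaw (fun ω => pointCount (fun i => X i ω) B)
      ((poissonMeasure (lam * volume.real B).toNNReal).map (fun n : ℕ => (n : ℕ∞))) P
  count_indep : ∀ (n : ℕ) (B : Fin n → Set Plane), (∀ k, MeasurableSet (B k)) →
    Pairwise (fun k k' => Disjoint (B k) (B k')) →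
    iIndepFun (fun k ω => pointCount (fun i => X i ω) (B k)) P

/-- Rayleigh fading for the base stations `X`: the variables `H i t` (base station `i`, time `t`)
are exponential with unit mean and mutually independent, and the whole family is independent of
the base station positions. -/
structure IsRayleighFading {Ω : Type*} [MeasurableSpace Ω] (P : Measure Ω)
    (X : ℕ → Ω → Plane) (H : ℕ → ℕ → Ω → ℝ) : Prop where
  measurable : ∀ i t, Measurable (H i t)
  law : ∀ i t, HasLaw (H i t) (expMeasure 1) P
  indep : iIndepFun (fun (p : ℕ × ℕ) ω => H p.1 p.2 ω) P
  indep_points : IndepFun (fun ω (i : ℕ) => X i ω) (fun ω (p : ℕ × ℕ) => H p.1 p.2 ω) P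

/-- Index of the point nearest to the origin (for a Poisson process almost surely there is exactly
one such index). -/
def nearestIndex (x : ℕ → Plane) : ℕ := sInf {i : ℕ | ∀ j, ‖x i‖ ≤ ‖x j‖}

/-- Interference power at position `u` when served by base station `i`; `h j` is the fading of base
station `j` at the time considered. -/
def interference (β : ℝ) (x : ℕ → Plane) (h : ℕ → ℝ) (u : Plane) (i : ℕ) : ℝ :=
  ∑' j : {j : ℕ // j ≠ i}, h j / ‖x j - u‖ ^ β

/-- Downlink signal to interference plus noise ratio at position `u`, served by base station `i`. -/
def sinr (σ β : ℝ) (x : ℕ → Plane) (h : ℕ → ℝ) (u : Plane) (i : ℕ) : ℝ :=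
  h i * ‖x i - u‖ ^ (-β) / (σ ^ 2 + interference β x h u i)

/-- Position at time `t` of the user moving at constant speed from the origin to `(l, 0)` in `s`
units of time. -/
def uePosition (s : ℕ) (l : ℝ) (t : ℕ) : Plane := !₂[l * t / s, 0]

/-- Data rate at time `t` of the movement period, the user staying attached to the base station
nearest to its starting point. -/
def skippingRate (σ β : ℝ) (s : ℕ) (l : ℝ) (x : ℕ → Plane) (h : ℕ → ℕ → ℝ) (t : ℕ) : ℝ :=
  Real.log (1 + sinr σ β x (fun i => h i t) (uePosition s l t) (nearestIndex x))

/-- Amount of data received during the movement period. -/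
def receivedData (σ β : ℝ) (s : ℕ) (l : ℝ) (x : ℕ → Plane) (h : ℕ → ℕ → ℝ) : ℝ :=
  ∑ t ∈ Finset.range s, skippingRate σ β s l x h t

/-- Expected amount of data received during the movement period. -/
def expectedData {Ω : Type*} [MeasurableSpace Ω] (P : Measure Ω) (X : ℕ → Ω → Plane)
    (H : ℕ → ℕ → Ω → ℝ) (σ β : ℝ) (s : ℕ) (l : ℝ) : ℝ :=
  ∫ ω, receivedData σ β s l (fun i => X i ω) (fun i t => H i t ω) ∂P

/-- Distance from `(u, 0)` to the point with polar coordinates `(r, θ)`. -/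
def w (u r θ : ℝ) : ℝ := √(u ^ 2 + r ^ 2 - 2 * u * r * Real.cos θ)

/-- Integrand of the exponent of `rho2`, in the polar coordinates `(v, φ)`. -/
def rho2Integrand (β z r θ u φ v : ℝ) : ℝ :=
  (1 + 1 / z * (w u v φ / w u r θ) ^ β)⁻¹ * v

/-- Laplace functional of the interference from the points outside the disk of radius `r`. -/
def rho2 (lam β z r θ u : ℝ) : ℝ :=
  Real.exp (-lam * ∫ φ in (0 : ℝ)..(2 * Real.pi), ∫ v in Ioi r, rho2Integrand β z r θ u φ v)

/-- Integrand of `tau2`. -/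
def tau2Integrand (lam σ β u θ r z : ℝ) : ℝ :=
  r * Real.exp (-lam * Real.pi * r ^ 2 - σ ^ 2 * w u r θ ^ β * z) *
    (rho2 lam β z r θ u / (1 + z))

/-- Expected data rate at distance `u` from the starting point. -/
def tau2 (lam σ β u : ℝ) : ℝ :=
  lam * ∫ θ in (0 : ℝ)..(2 * Real.pi), ∫ r in Ioi (0 : ℝ), ∫ z in Ioi (0 : ℝ),
    tau2Integrand lam σ β u θ r z

end HandoverSkipping

end

open HandoverSkipping

open Filter Topology
open scoped ENNReal NNReal

/-! Writing log(1 + S) as the integral over z > 0 of 1_{z < S}/(1 + z) (`ofReal_log_one_add`) turns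
the mean rate into an integral of the coverage probabilities P(SINR > z). Freeze the points, hence
the serving index b. Then SINR > z says that the exponential variable H_b exceeds a threshold built
from the other fadings, which are independent of it. The conditional coverage probability is
therefore (`measure_lt_fading`) the noise factor exp(-σ² w^β z) times the product over j ≠ b of 1/(1
+ z w^β ‖X_j - u‖^(-β)), with w the distance from the user to X_b.

What remains is the mean of f(X_b) exp(-∑_{j ≠ b} G(X_b, X_j)) over the Poisson points. By
`lintegral_nearest`, X_b has density λ exp(-λπ‖x‖²) and, given X_b = x, the other points are Poisson
outside the disk of radius ‖x‖. Since only the laws of counts are assumed, this is proved by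
discretisation. Cut the plane into squares of side 1/(n + 1), and for each square consider the event
that it holds exactly one point and that a disk covering it holds no other. Counts in disjoint sets
are independent, so `laplace_functional` evaluates each contribution exactly (`lintegral_cellTerm`);
an exponent equal to ∞ on the disk encodes its emptiness. As n → ∞ the sum over squares converges
almost surely to the functional at the true nearest point, while its expectation converges to the
integral. The case f = 1, G = 0 has limit 1, and this yields a nearest point with a positive gap
(`ae_exists_isStrictNearest`).

Polar coordinates turn the outcome into τ₂ (`ofReal_tau2`). Expectations are computed in [0, ∞], so
finiteness is settled separately, by exp(-y) ≤ y^(-1/β) at y = σ² w^β z: the resulting singularities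
z^(-1/β)/(1 + z) on the half-line and 1/w in the plane are integrable
(`lintegral_rateDensity_ne_top`). -/

namespace HandoverSkipping

/-! ### Extended exponential and Poisson counts -/

section

/-- The function `s ↦ exp (-s)` on `[0, ∞]`. -/
noncomputable def expNeg (s : ℝ≥0∞) : ℝ≥0∞ := EReal.exp (-(s : EReal))

@[simp] lemma expNeg_zero : expNeg 0 = 1 := by simp [expNeg]

@[simp] lemma expNeg_top : expNeg ⊤ = 0 := by simp [expNeg]

lemma expNeg_add (a b : ℝ≥0∞) : expNeg (a + b) = expNeg a * expNeg b := by
  rw [expNeg, EReal.coe_ennreal_add, EReal.neg_add (Or.inl (EReal.coe_ennreal_ne_bot _))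
    (Or.inr (EReal.coe_ennreal_ne_bot _)), sub_eq_add_neg, EReal.exp_add]
  rfl

lemma expNeg_antitone : Antitone expNeg := fun a b h => by
  unfold expNeg
  gcongr
  simpa using h

lemma expNeg_le_one (a : ℝ≥0∞) : expNeg a ≤ 1 := by
  rw [← expNeg_zero]; exact expNeg_antitone zero_le

lemma expNeg_ne_top (a : ℝ≥0∞) : expNeg a ≠ ⊤ := (expNeg_le_one a).trans_lt ENNReal.one_lt_top |>.ne

lemma continuous_expNeg : Continuous expNeg :=
  ENNReal.continuous_exp.comp (continuous_neg.comp continuous_coe_ennreal_ereal)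

@[fun_prop] lemma measurable_expNeg : Measurable expNeg := continuous_expNeg.measurable

lemma expNeg_ofReal {x : ℝ} (hx : 0 ≤ x) :
    expNeg (ENNReal.ofReal x) = ENNReal.ofReal (Real.exp (-x)) := by
  rw [expNeg, EReal.coe_ennreal_ofReal, max_eq_left hx, ← EReal.coe_neg, EReal.exp_coe]

lemma expNeg_sum {ι : Type*} (F : Finset ι) (f : ι → ℝ≥0∞) :
    expNeg (∑ i ∈ F, f i) = ∏ i ∈ F, expNeg (f i) := by
  classical
  induction F using Finset.induction_on with
  | empty => simp
  | insert i F hi ih => rw [Finset.sum_insert hi, Finset.prod_insert hi, expNeg_add, ih]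

/-- The value 1/(1 + a) is the Laplace transform of a unit exponential variable; in this form,
products over points become sums in the exponent. -/
lemma expNeg_log {a : ℝ} (ha : 0 ≤ a) :
    expNeg (ENNReal.ofReal (Real.log (1 + a))) = ENNReal.ofReal (1 + a)⁻¹ := by
  rw [expNeg_ofReal (Real.log_nonneg (by linarith)), Real.exp_neg, Real.exp_log (by linarith)]

lemma tendsto_tsum_of_monotone {ι : Type*} [Countable ι] {f : ℕ → ι → ℝ≥0∞} {g : ι → ℝ≥0∞}
    (hf : ∀ i, Monotone fun n => f n i) (hg : ∀ i, Tendsto (fun n => f n i) atTop (𝓝 (g i))) :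
    Tendsto (fun n => ∑' i, f n i) atTop (𝓝 (∑' i, g i)) := by
  let _ : MeasurableSpace ι := ⊤
  simp only [← lintegral_count]
  exact lintegral_tendsto_of_tendsto_of_monotone (fun n => (measurable_of_countable _).aemeasurable)
    (ae_of_all _ hf) (ae_of_all _ hg)

lemma tendsto_tsum_of_dominated {ι : Type*} [Countable ι] {α : Type*} {l : Filter α}
    [l.IsCountablyGenerated] {f : α → ι → ℝ≥0∞}
    {g b : ι → ℝ≥0∞} (hb : ∑' i, b i ≠ ⊤) (hf : ∀ᶠ n in l, ∀ i, f n i ≤ b i)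
    (hg : ∀ i, Tendsto (fun n => f n i) l (𝓝 (g i))) :
    Tendsto (fun n => ∑' i, f n i) l (𝓝 (∑' i, g i)) := by
  let _ : MeasurableSpace ι := ⊤
  simp only [← lintegral_count] at hb ⊢
  exact tendsto_lintegral_filter_of_dominated_convergence b
    (Eventually.of_forall fun n => measurable_of_countable _)
    (hf.mono fun n h => ae_of_all _ h) hb (ae_of_all _ hg)

variable {Ω : Type*} [MeasurableSpace Ω] {P : Measure Ω} {lam : ℝ} {X : ℕ → Ω → Plane}

lemma pointCount_toENNReal (x : ℕ → Plane) (B : Set Plane) :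
    ((pointCount x B : ℕ∞) : ℝ≥0∞) = ∑' j, B.indicator 1 (x j) := by
  rw [pointCount, ← Measure.count_apply (MeasurableSpace.measurableSet_top),
    ← lintegral_indicator_one MeasurableSpace.measurableSet_top, lintegral_count]
  rfl

lemma measurable_pointCount (hX : IsHomogeneousPPP P lam X) {B : Set Plane}
    (hB : MeasurableSet B) : Measurable fun ω => pointCount (fun i => X i ω) B := by
  have h : Measurable fun ω => ((pointCount (fun i => X i ω) B : ℕ∞) : ℝ≥0∞) := by
    simp only [pointCount_toENNReal]
    exact Measurable.tsum fun j =>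
      (measurable_one.indicator hB).comp (hX.measurable j)
  refine measurable_to_countable' fun n => ?_
  convert h (measurableSet_singleton (n : ℝ≥0∞)) using 1
  ext ω
  simp

lemma lintegral_pointCount (hX : IsHomogeneousPPP P lam X) {B : Set Plane}
    (hB : MeasurableSet B) (hv : volume B ≠ ⊤) (φ : ℕ∞ → ℝ≥0∞) :
    ∫⁻ ω, φ (pointCount (fun i => X i ω) B) ∂P =
      ∑' n : ℕ, φ n * poissonMeasure (lam * volume.real B).toNNReal {n} := by
  have h := hX.count_law B hB hv
  rw [← lintegral_map' (f := φ) (measurable_of_countable φ).aemeasurable h.aemeasurable, h.map_eq,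
    lintegral_map (measurable_of_countable φ) (measurable_of_countable _), lintegral_countable']

/-- Sum the exponential series at m exp(-a). -/
lemma poisson_laplace (m : ℝ≥0) {a : ℝ} (ha : 0 ≤ a) :
    ∑' n : ℕ, expNeg (ENNReal.ofReal a * n) * poissonMeasure m {n} =
      ENNReal.ofReal (Real.exp (-(m * (1 - Real.exp (-a))))) := by
  have h1 : ∀ n : ℕ, expNeg (ENNReal.ofReal a * n) * poissonMeasure m {n} =
      ENNReal.ofReal (Real.exp (-m) * ((m * Real.exp (-a)) ^ n / n.factorial)) := by
    intro n
    rw [poissonMeasure_singleton, ← ENNReal.ofReal_natCast, ← ENNReal.ofReal_mul ha,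
      expNeg_ofReal (by positivity), ← ENNReal.ofReal_mul (by positivity), mul_pow,
      ← Real.exp_nat_mul]
    ring_nf
  have h2 := (NormedSpace.expSeries_div_hasSum_exp (m * Real.exp (-a))).mul_left (Real.exp (-m))
  rw [← Real.exp_eq_exp_ℝ] at h2
  simp only [h1]
  rw [← ENNReal.ofReal_tsum_of_nonneg (fun n => by positivity) h2.summable, h2.tsum_eq,
    ← Real.exp_add]
  ring_nf

lemma lintegral_expNeg_pointCount (hlam : 0 < lam) (hX : IsHomogeneousPPP P lam X) {B : Set Plane}
    (hB : MeasurableSet B) (hv : volume B ≠ ⊤) {a : ℝ≥0∞} (ha : a ≠ ⊤) :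
    ∫⁻ ω, expNeg (a * pointCount (fun i => X i ω) B) ∂P =
      expNeg (ENNReal.ofReal lam * (volume B * (1 - expNeg a))) := by
  have h := lintegral_pointCount hX hB hv (fun n => expNeg (a * n))
  rw [h, ← ENNReal.ofReal_toReal ha, ← ENNReal.ofReal_toReal hv]
  simp only [ENat.toENNReal_coe]
  rw [poisson_laplace _ ENNReal.toReal_nonneg, expNeg_ofReal ENNReal.toReal_nonneg,
    ← ENNReal.ofReal_one, ← ENNReal.ofReal_sub _ (Real.exp_nonneg _),
    ← ENNReal.ofReal_mul ENNReal.toReal_nonneg, ← ENNReal.ofReal_mul hlam.le, expNeg_ofReal,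
    Real.coe_toNNReal _ (by positivity), mul_assoc]
  · simp [Measure.real]
  · have : Real.exp (-a.toReal) ≤ 1 := by simp
    have : 0 ≤ 1 - Real.exp (-a.toReal) := by linarith
    positivity

end

/-! ### Laplace functional and intensity measure -/

section

variable {Ω : Type*} [MeasurableSpace Ω] {P : Measure Ω} {lam : ℝ} {X : ℕ → Ω → Plane}

lemma iIndepFun_pointCount (hX : IsHomogeneousPPP P lam X) {ι : Type*} [Fintype ι]
    (B : ι → Set Plane) (hB : ∀ k, MeasurableSet (B k))
    (hd : Pairwise fun k k' => Disjoint (B k) (B k')) :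
    iIndepFun (fun k ω => pointCount (fun i => X i ω) (B k)) P := by
  have e := Fintype.equivFin ι
  have h := hX.count_indep _ (fun k => B (e.symm k)) (fun k => hB _)
    (fun k k' hk => hd (e.symm.injective.ne hk))
  simpa using h.precomp e.injective

/-- The level set of 0 may have infinite area, so it must not appear; ψ 0 = 0 makes it dispensable.
Used for ψ = `id` and for ψ a = 1 - exp(-a). -/
lemma simpleFunc_comp_eq_sum (g : SimpleFunc Plane ℝ≥0∞) {ψ : ℝ≥0∞ → ℝ≥0∞} (hψ : ψ 0 = 0)
    (x : Plane) :
    ψ (g x) = ∑ a : {a // a ∈ g.range.filter (· ≠ 0)}, ψ a * (g ⁻¹' {a.1}).indicator 1 x := by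
  rw [Finset.sum_coe_sort (g.range.filter (· ≠ 0))
    (fun a => ψ a * (g ⁻¹' {a}).indicator 1 x)]
  by_cases h0 : g x = 0
  · rw [h0, hψ]
    refine (Finset.sum_eq_zero fun a ha => ?_).symm
    rw [indicator_of_notMem, mul_zero]
    simp only [mem_preimage, mem_singleton_iff, h0]
    exact fun h => (Finset.mem_filter.1 ha).2 h.symm
  · rw [Finset.sum_eq_single (g x)]
    · simp
    · intro b _ hb
      rw [indicator_of_notMem, mul_zero]
      exact fun h => hb h.symm
    · intro h
      exact absurd (Finset.mem_filter.2 ⟨g.mem_range_self x, h0⟩) h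

/-- The nonzero level sets of `g` and the set `C`, where `g` vanishes, are disjoint, so their counts
are independent and the expectation factors. In `Option F`, `none` stands for `C`. -/
lemma laplace_simpleFunc [IsProbabilityMeasure P] (hlam : 0 < lam) (hX : IsHomogeneousPPP P lam X)
    {C : Set Plane} (hC : MeasurableSet C) (φ : ℕ∞ → ℝ≥0∞) (g : SimpleFunc Plane ℝ≥0∞)
    (hg : ∀ x, g x ≠ ⊤) (hv : volume (Function.support g) ≠ ⊤) (h0 : ∀ x ∈ C, g x = 0) :
    ∫⁻ ω, φ (pointCount (fun i => X i ω) C) * expNeg (∑' j, g (X j ω)) ∂P =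
      (∫⁻ ω, φ (pointCount (fun i => X i ω) C) ∂P) *
        expNeg (ENNReal.ofReal lam * ∫⁻ x, (1 - expNeg (g x))) := by
  set F := g.range.filter (· ≠ 0)
  let B : Option F → Set Plane := fun o => o.elim C fun a => g ⁻¹' {a.1}
  have hB : ∀ k, MeasurableSet (B k) := by
    rintro (_ | a)
    · exact hC
    · exact g.measurableSet_preimage _
  have hF : ∀ a : F, a.1 ≠ 0 := fun a => (Finset.mem_filter.1 a.2).2
  have hd : Pairwise fun k k' => Disjoint (B k) (B k') := by
    have key : ∀ a : F, Disjoint C (g ⁻¹' {a.1}) := fun a =>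
      disjoint_left.2 fun x hx hxa => hF a (by rw [← h0 x hx]; exact hxa.symm)
    rintro (_ | a) (_ | b) hab
    · exact absurd rfl hab
    · exact key b
    · exact (key a).symm
    · refine disjoint_left.2 fun x hx hx' => hab ?_
      exact congrArg some (Subtype.ext (hx.symm.trans hx'))
  have hBv : ∀ a : F, volume (g ⁻¹' {a.1}) ≠ ⊤ := fun a =>
    ne_top_of_le_ne_top hv (measure_mono fun x hx => by
      have : g x = a.1 := hx
      simp [this, hF a])
  have hBt : ∀ a : F, a.1 ≠ ⊤ := fun a => by
    obtain ⟨x, hx⟩ := SimpleFunc.mem_range.1 (Finset.mem_filter.1 a.2).1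
    rw [← hx]; exact hg x
  let Ψ : Option F → ℕ∞ → ℝ≥0∞ := fun o n => o.elim (φ n) fun a => expNeg (a.1 * n)
  have hind := (iIndepFun_pointCount hX B hB hd).comp Ψ fun _ => measurable_of_countable _
  have hm : ∀ k, Measurable (Ψ k ∘ fun ω => pointCount (fun i => X i ω) (B k)) := fun k =>
    (measurable_of_countable _).comp (measurable_pointCount hX (hB k))
  have hprod := lintegral_prod_eq_prod_lintegral_of_indepFun Finset.univ _ hind hm
  simp only [Fintype.prod_option] at hprod
  have h1 : ∀ ω, ∑' j, g (X j ω) = ∑ a : F, a.1 * pointCount (fun i => X i ω) (g ⁻¹' {a.1}) := by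
    intro ω
    simp only [pointCount_toENNReal, ← ENNReal.tsum_mul_left]
    rw [← Summable.tsum_finsetSum fun _ _ => ENNReal.summable]
    exact tsum_congr fun j => simpleFunc_comp_eq_sum g (ψ := id) rfl _
  have h2 : ∫⁻ x, (1 - expNeg (g x)) = ∑ a : F, volume (g ⁻¹' {a.1}) * (1 - expNeg a.1) := by
    have := fun x => simpleFunc_comp_eq_sum g (ψ := fun a => 1 - expNeg a) (by simp) x
    simp only [this]
    rw [lintegral_finsetSum]
    · refine Finset.sum_congr rfl fun a _ => ?_
      rw [lintegral_const_mul _ (measurable_one.indicator (g.measurableSet_preimage _)),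
        lintegral_indicator_one (g.measurableSet_preimage _), mul_comm]
    · exact fun a _ => (measurable_one.indicator (g.measurableSet_preimage _)).const_mul _
  simp only [h1, h2, expNeg_sum, Finset.mul_sum]
  refine hprod.trans ?_
  congr 1
  exact Finset.prod_congr rfl fun a _ =>
    lintegral_expNeg_pointCount hlam hX (g.measurableSet_preimage _) (hBv a) (hBt a)

/-- Increasing approximation by simple functions. The factor φ(count in `C`) will select the squares
that hold exactly one point. -/
lemma laplace_functional [IsProbabilityMeasure P] (hlam : 0 < lam) (hX : IsHomogeneousPPP P lam X)
    {C : Set Plane} (hC : MeasurableSet C) (φ : ℕ∞ → ℝ≥0∞) (hφ : ∀ n, φ n ≤ 1)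
    {h : Plane → ℝ≥0∞} (hh : Measurable h) (h0 : ∀ x ∈ C, h x = 0) :
    ∫⁻ ω, φ (pointCount (fun i => X i ω) C) * expNeg (∑' j, h (X j ω)) ∂P =
      (∫⁻ ω, φ (pointCount (fun i => X i ω) C) ∂P) *
        expNeg (ENNReal.ofReal lam * ∫⁻ x, (1 - expNeg (h x))) := by
  -- `eapprox` has finite values, and the restriction to a ball gives a support of finite area; the
  -- simple case needs both.
  let g : ℕ → SimpleFunc Plane ℝ≥0∞ := fun n =>
    (SimpleFunc.eapprox h n).restrict (Metric.ball 0 n)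
  have hgx : ∀ n x, g n x = (Metric.ball 0 (n : ℝ)).indicator (SimpleFunc.eapprox h n) x :=
    fun n x => by rw [SimpleFunc.restrict_apply _ measurableSet_ball]
  have hmono : ∀ x, Monotone fun n => g n x := by
    intro x m n hmn
    simp only [hgx]
    refine (indicator_le_indicator_of_subset (Metric.ball_subset_ball (by exact_mod_cast hmn))
      (fun _ => zero_le) x).trans (indicator_le_indicator ?_)
    exact SimpleFunc.monotone_eapprox h hmn x
  have hlim : ∀ x, Tendsto (fun n => g n x) atTop (𝓝 (h x)) := by
    intro x
    have h1 : Tendsto (fun n => SimpleFunc.eapprox h n x) atTop (𝓝 (h x)) := by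
      rw [← SimpleFunc.iSup_eapprox_apply hh x]
      exact tendsto_atTop_iSup fun m n hmn => SimpleFunc.monotone_eapprox h hmn x
    refine h1.congr' ?_
    obtain ⟨N, hN⟩ := exists_nat_gt ‖x‖
    filter_upwards [eventually_ge_atTop N] with n hn
    rw [hgx, indicator_of_mem]
    rw [mem_ball_zero_iff]
    exact hN.trans_le (by exact_mod_cast hn)
  have hle : ∀ n x, g n x ≤ h x := fun n x => (hmono x).ge_of_tendsto (hlim x) n
  have hsimple := fun n => laplace_simpleFunc hlam hX hC φ (g n)
    (fun x => by
      rw [hgx]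
      refine ne_top_of_le_ne_top (SimpleFunc.eapprox_lt_top h n x).ne ?_
      exact indicator_le_self' (fun _ _ => zero_le) x)
    (ne_top_of_le_ne_top (measure_ball_lt_top (x := (0 : Plane)) (r := n)).ne (measure_mono
      fun x hx => by
        by_contra hxn
        exact hx (by rw [hgx, indicator_of_notMem hxn])))
    (fun x hx => le_antisymm ((hle n x).trans_eq (h0 x hx)) zero_le)
  have hL : Tendsto (fun n => ∫⁻ ω, φ (pointCount (fun i => X i ω) C) *
      expNeg (∑' j, g n (X j ω)) ∂P) atTop
      (𝓝 (∫⁻ ω, φ (pointCount (fun i => X i ω) C) * expNeg (∑' j, h (X j ω)) ∂P)) := by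
    refine tendsto_lintegral_of_dominated_convergence 1 (fun n => ?_)
      (fun n => ae_of_all _ fun ω => ?_) (by simp) (ae_of_all _ fun ω => ?_)
    · refine ((measurable_of_countable φ).comp (measurable_pointCount hX hC)).mul
        (measurable_expNeg.comp (Measurable.tsum fun j => ?_))
      exact (g n).measurable.comp (hX.measurable j)
    · exact mul_le_one' (hφ _) (expNeg_le_one _)
    · refine ENNReal.Tendsto.const_mul ?_ (Or.inr (ne_top_of_le_ne_top ENNReal.one_ne_top (hφ _)))
      exact (continuous_expNeg.tendsto _).comp
        (tendsto_tsum_of_monotone (fun j => hmono _) fun j => hlim _)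
  have hR : Tendsto (fun n => ∫⁻ x, (1 - expNeg (g n x))) atTop
      (𝓝 (∫⁻ x, (1 - expNeg (h x)))) := by
    refine lintegral_tendsto_of_tendsto_of_monotone
      (fun n => (by fun_prop : Measurable _).aemeasurable)
      (ae_of_all _ fun x m n hmn => ?_) (ae_of_all _ fun x => ?_)
    · exact tsub_le_tsub_left (expNeg_antitone (hmono x hmn)) _
    · exact ENNReal.Tendsto.sub tendsto_const_nhds
        ((continuous_expNeg.tendsto _).comp (hlim x)) (Or.inl ENNReal.one_ne_top)
  refine tendsto_nhds_unique hL ?_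
  simp only [hsimple]
  refine ENNReal.Tendsto.const_mul ?_ (Or.inr ?_)
  · exact (continuous_expNeg.tendsto _).comp
      (ENNReal.Tendsto.const_mul hR (Or.inr ENNReal.ofReal_ne_top))
  · refine ne_top_of_le_ne_top (b := 1) ENNReal.one_ne_top ?_
    calc ∫⁻ ω, φ (pointCount (fun i => X i ω) C) ∂P ≤ ∫⁻ ω, 1 ∂P := lintegral_mono fun ω => hφ _
      _ = 1 := by simp

lemma lintegral_indicator_pointCount_eq_one (hlam : 0 < lam) (hX : IsHomogeneousPPP P lam X)
    {C : Set Plane} (hC : MeasurableSet C) (hv : volume C ≠ ⊤) :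
    ∫⁻ ω, ({1} : Set ℕ∞).indicator 1 (pointCount (fun i => X i ω) C) ∂P =
      ENNReal.ofReal lam * volume C * expNeg (ENNReal.ofReal lam * volume C) := by
  rw [lintegral_pointCount hX hC hv, tsum_eq_single 1]
  · rw [← ENNReal.ofReal_toReal hv, ← ENNReal.ofReal_mul hlam.le, expNeg_ofReal (by positivity),
      poissonMeasure_singleton, ← ENNReal.ofReal_mul (by positivity),
      Real.coe_toNNReal _ (by positivity)]
    simp [Measure.real, mul_comm]
  · intro n hn
    rw [indicator_of_notMem, zero_mul]
    simpa using hn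

/-- Campbell's theorem for the numbering of the points: the intensity measure. -/
lemma sum_map_eq (hlam : 0 < lam) (hX : IsHomogeneousPPP P lam X) :
    Measure.sum (fun j => P.map (X j)) = ENNReal.ofReal lam • (volume : Measure Plane) := by
  have key : ∀ B : Set Plane, MeasurableSet B → volume B ≠ ⊤ →
      Measure.sum (fun j => P.map (X j)) B = ENNReal.ofReal lam * volume B := by
    intro B hB hv
    rw [Measure.sum_apply _ hB]
    have h1 : ∀ j, P.map (X j) B = ∫⁻ ω, B.indicator 1 (X j ω) ∂P := fun j => by
      rw [← lintegral_indicator_one hB, lintegral_map (measurable_one.indicator hB)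
        (hX.measurable j)]
    simp only [h1]
    rw [← lintegral_tsum (f := fun j ω => B.indicator 1 (X j ω)) fun j => ((measurable_one.indicator hB).comp
      (hX.measurable j)).aemeasurable]
    simp only [← pointCount_toENNReal]
    rw [lintegral_pointCount hX hB hv (fun n => (n : ℝ≥0∞)), tsum_eq_zero_add' ENNReal.summable]
    set m := (lam * volume.real B).toNNReal with hm
    -- The identity (n + 1) p(n + 1) = m p(n) reduces the Poisson mean to m times the total mass.
    have h2 : ∀ n : ℕ, (((n + 1 : ℕ) : ℕ∞) : ℝ≥0∞) * poissonMeasure m {n + 1} =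
        m * poissonMeasure m {n} := by
      intro n
      rw [poissonMeasure_singleton, poissonMeasure_singleton, ENat.toENNReal_coe,
        ← ENNReal.ofReal_natCast, ← ENNReal.ofReal_mul (by positivity),
        ← ENNReal.ofReal_coe_nnreal, ← ENNReal.ofReal_mul (by positivity)]
      congr 1
      rw [Nat.factorial_succ]
      push_cast
      field_simp
      ring
    simp only [h2, ENNReal.tsum_mul_left]
    have h3 : ∑' n, poissonMeasure m {n} = 1 := by
      rw [← measure_univ (μ := poissonMeasure m), ← lintegral_one, lintegral_countable']
      simp
    rw [h3, hm]
    simp only [Nat.cast_zero, ENat.toENNReal_zero, zero_mul, zero_add, mul_one]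
    rw [← ENNReal.ofReal, ENNReal.ofReal_mul hlam.le, Measure.real, ENNReal.ofReal_toReal hv]
  ext B hB
  -- The count law is assumed only for finite area, hence the exhaustion by balls.
  have hU : B = ⋃ n : ℕ, B ∩ Metric.ball 0 n := by
    rw [← inter_iUnion, Metric.iUnion_ball_nat, inter_univ]
  have hmono : Monotone fun n : ℕ => B ∩ Metric.ball (0 : Plane) n := fun m n hmn =>
    inter_subset_inter_right _ (Metric.ball_subset_ball (by exact_mod_cast hmn))
  rw [hU, hmono.measure_iUnion, hmono.measure_iUnion]
  refine iSup_congr fun n => ?_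
  rw [key _ (hB.inter measurableSet_ball) (ne_top_of_le_ne_top
    (measure_ball_lt_top (x := (0 : Plane)) (r := n)).ne (measure_mono inter_subset_right))]
  simp

lemma lintegral_tsum_points (hlam : 0 < lam) (hX : IsHomogeneousPPP P lam X)
    {f : Plane → ℝ≥0∞} (hf : Measurable f) :
    ∫⁻ ω, ∑' j, f (X j ω) ∂P = ENNReal.ofReal lam * ∫⁻ x, f x := by
  rw [lintegral_tsum (f := fun j ω => f (X j ω)) fun j => (hf.comp (hX.measurable j)).aemeasurable, ← smul_eq_mul, ← lintegral_smul_measure,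
    ← sum_map_eq hlam hX, lintegral_sum_measure]
  exact tsum_congr fun j => (lintegral_map hf (hX.measurable j)).symm

end

/-! ### Locating the nearest point on a grid -/

section

/-- The square of side `1 / (n + 1)` containing `x`. -/
noncomputable def cell (n : ℕ) (x : Plane) : ℤ × ℤ := (⌊(n + 1) * x 0⌋, ⌊(n + 1) * x 1⌋)

/-- Lower left corner of a square of the grid of side `1 / (n + 1)`. -/
noncomputable def corner (n : ℕ) (k : ℤ × ℤ) : Plane := !₂[(k.1 : ℝ) / (n + 1), (k.2 : ℝ) / (n + 1)]

/-- Margin larger than the diameter of the squares of side `1 / (n + 1)`. -/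
noncomputable def margin (n : ℕ) : ℝ := 3 / (n + 1)

lemma measurable_cell (n : ℕ) : Measurable (cell n) := by
  unfold cell
  fun_prop

lemma margin_pos (n : ℕ) : 0 < margin n := by unfold margin; positivity

lemma tendsto_margin : Tendsto margin atTop (𝓝 0) := by
  have := (tendsto_one_div_add_atTop_nhds_zero_nat (𝕜 := ℝ)).const_mul 3
  simp only [mul_zero, mul_one_div] at this
  exact this

lemma norm_le_abs_add_abs (x : Plane) : ‖x‖ ≤ |x 0| + |x 1| := by
  rw [EuclideanSpace.norm_eq, Fin.sum_univ_two]
  refine Real.sqrt_le_iff.2 ⟨by positivity, ?_⟩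
  simp only [Real.norm_eq_abs]
  nlinarith [abs_nonneg (x 0), abs_nonneg (x 1)]

/-- Each coordinate moves by at most 1/(n + 1), so the norm by at most 2/(n + 1). The third unit in
`margin` is slack; it becomes the gap between the nearest point and the others in
`cellTerm_ne_zero`. -/
lemma norm_corner_sub_le (n : ℕ) (x : Plane) :
    ‖corner n (cell n x) - x‖ + 1 / (n + 1) ≤ margin n := by
  have hn : (0 : ℝ) < n + 1 := by positivity
  have key : ∀ a : ℝ, |(⌊(n + 1) * a⌋ : ℝ) / (n + 1) - a| ≤ 1 / (n + 1) := by
    intro a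
    have h1 := Int.floor_le ((n + 1) * a)
    have h2 := Int.lt_floor_add_one ((n + 1) * a)
    have h3 : (⌊(n + 1) * a⌋ : ℝ) / (n + 1) - a = (⌊(n + 1) * a⌋ - (n + 1) * a) / (n + 1) := by
      field_simp
    rw [h3, abs_div, abs_of_pos hn]
    gcongr
    rw [abs_le]
    constructor <;> linarith
  have h := norm_le_abs_add_abs (corner n (cell n x) - x)
  have h0 := key (x 0)
  have h1 := key (x 1)
  simp only [corner, cell, PiLp.sub_apply, margin] at h ⊢
  simp only [Matrix.cons_val_zero, Matrix.cons_val_one] at h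
  have : (3 : ℝ) / (n + 1) = 1 / (n + 1) + 1 / (n + 1) + 1 / (n + 1) := by ring
  linarith

lemma norm_lt_corner_add_margin (n : ℕ) (x : Plane) :
    ‖x‖ + 1 / (n + 1) ≤ ‖corner n (cell n x)‖ + margin n := by
  have h1 := norm_corner_sub_le n x
  have h2 := norm_sub_norm_le x (corner n (cell n x))
  rw [norm_sub_rev] at h2
  linarith

lemma norm_le_corner_add_margin (n : ℕ) (x : Plane) :
    ‖x‖ ≤ ‖corner n (cell n x)‖ + margin n := by
  have h := norm_lt_corner_add_margin n x
  have : (0 : ℝ) < 1 / (n + 1) := by positivity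
  linarith

lemma norm_corner_le (n : ℕ) (x : Plane) : ‖corner n (cell n x)‖ ≤ ‖x‖ + margin n := by
  have h1 := norm_corner_sub_le n x
  have h2 := norm_sub_norm_le (corner n (cell n x)) x
  have : (0 : ℝ) < 1 / (n + 1) := by positivity
  linarith

lemma tendsto_corner (x : Plane) : Tendsto (fun n => corner n (cell n x)) atTop (𝓝 x) := by
  rw [tendsto_iff_norm_sub_tendsto_zero]
  refine squeeze_zero (fun n => norm_nonneg _) (fun n => ?_) tendsto_margin
  have h1 := norm_corner_sub_le n x
  have : (0 : ℝ) < 1 / (n + 1) := by positivity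
  linarith

open Classical in
/-- The function `g` outside the disk of radius `r`, infinite on the disk. -/
noncomputable def killDisk (r : ℝ) (g : Plane → ℝ≥0∞) (y : Plane) : ℝ≥0∞ :=
  if ‖y‖ ≤ r then ⊤ else g y

/-- Expectation of `exp (-∑ g)` on the event that the disk of radius `r` has no point. -/
noncomputable def voidLaplace (lam r : ℝ) (g : Plane → ℝ≥0∞) : ℝ≥0∞ :=
  expNeg (ENNReal.ofReal lam * ∫⁻ y, (1 - expNeg (killDisk r g y)))

lemma measurable_killDisk (r : ℝ) {g : Plane → ℝ≥0∞} (hg : Measurable g) :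
    Measurable (killDisk r g) :=
  Measurable.ite (measurableSet_le measurable_norm measurable_const) measurable_const hg

lemma voidLaplace_le (lam r : ℝ) (g : Plane → ℝ≥0∞) :
    voidLaplace lam r g ≤ voidLaplace lam r 0 := by
  refine expNeg_antitone ?_
  gcongr with y
  refine expNeg_antitone ?_
  unfold killDisk
  split_ifs <;> simp

lemma voidLaplace_zero {lam r : ℝ} (hlam : 0 < lam) (hr : 0 ≤ r) :
    voidLaplace lam r 0 = ENNReal.ofReal (Real.exp (-(lam * Real.pi * r ^ 2))) := by
  have h : ∀ y, 1 - expNeg (killDisk r 0 y) = (Metric.closedBall (0 : Plane) r).indicator 1 y := by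
    intro y
    by_cases hy : ‖y‖ ≤ r <;> simp [killDisk, hy]
  rw [voidLaplace]
  simp only [h]
  rw [lintegral_indicator_one measurableSet_closedBall,
    EuclideanSpace.volume_closedBall_fin_two,
    ← ENNReal.ofReal_pow hr, ← ENNReal.ofReal_mul (by positivity), ← ENNReal.ofReal_mul hlam.le,
    expNeg_ofReal (by positivity)]
  ring_nf

/-- A Gaussian integral: the candidate density of the nearest point has total mass 1. -/
lemma lintegral_voidLaplace_zero {lam : ℝ} (hlam : 0 < lam) :
    ENNReal.ofReal lam * ∫⁻ x : Plane, voidLaplace lam ‖x‖ 0 = 1 := by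
  simp only [voidLaplace_zero hlam (norm_nonneg _)]
  have h := GaussianFourier.integral_rexp_neg_mul_sq_norm (V := Plane)
    (b := lam * Real.pi) (by positivity)
  have hpos : (0 : ℝ) < lam * Real.pi := by positivity
  simp only [finrank_euclideanSpace, Fintype.card_fin] at h
  have h' : ∫ v : Plane, Real.exp (-(lam * Real.pi * ‖v‖ ^ 2)) = lam⁻¹ := by
    simp only [neg_mul] at h
    rw [h]
    norm_num
    field_simp
  rw [← ofReal_integral_eq_lintegral_ofReal, h', ← ENNReal.ofReal_mul hlam.le,
    mul_inv_cancel₀ hlam.ne', ENNReal.ofReal_one]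
  -- The integral of a non-integrable function is 0 by convention, whereas this one is λ⁻¹.
  · by_contra hni
    rw [integral_undef hni] at h'
    exact (inv_pos.2 hlam).ne h'
  · exact ae_of_all _ fun x => (Real.exp_pos _).le

variable {Ω : Type*} [MeasurableSpace Ω] {P : Measure Ω} {lam : ℝ} {X : ℕ → Ω → Plane}

open Classical in
/-- Contribution of the square `k`: the indicator that `k` contains exactly one point and that the
disk up to `k` contains no other, times `exp (-∑ g)` over the points outside `k`. -/
noncomputable def cellTerm (n : ℕ) (k : ℤ × ℤ) (g : Plane → ℝ≥0∞) (x : ℕ → Plane) : ℝ≥0∞ :=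
  ({1} : Set ℕ∞).indicator 1 (pointCount x (cell n ⁻¹' {k})) *
    expNeg (∑' j, if x j ∈ cell n ⁻¹' {k} then 0 else
      killDisk (‖corner n k‖ + margin n) g (x j))

lemma measurable_cellTerm (hX : IsHomogeneousPPP P lam X) (n : ℕ) (k : ℤ × ℤ)
    {g : Plane → ℝ≥0∞} (hg : Measurable g) :
    Measurable fun ω => cellTerm n k g (fun i => X i ω) := by
  classical
  have hC : MeasurableSet (cell n ⁻¹' {k}) := measurable_cell n (measurableSet_singleton k)
  have h1 : Measurable fun m : ℕ∞ => ({1} : Set ℕ∞).indicator (1 : ℕ∞ → ℝ≥0∞) m :=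
    measurable_of_countable _
  have h2 : Measurable fun y => if y ∈ cell n ⁻¹' {k} then (0 : ℝ≥0∞) else
      killDisk (‖corner n k‖ + margin n) g y :=
    Measurable.ite hC measurable_const (measurable_killDisk _ hg)
  exact (h1.comp (measurable_pointCount hX hC)).mul
    (measurable_expNeg.comp (Measurable.tsum fun j => h2.comp (hX.measurable j)))

/-- The square `C` lies in the disk, and P(one point in C) = λ|C| exp(-λ|C|). The exponential
supplies the part of the void probability of the disk that the points outside `C` do not see,
leaving λ|C| times the full void term. -/
lemma lintegral_cellTerm [IsProbabilityMeasure P] (hlam : 0 < lam) (hX : IsHomogeneousPPP P lam X)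
    (n : ℕ) (k : ℤ × ℤ) {g : Plane → ℝ≥0∞} (hg : Measurable g) :
    ∫⁻ ω, cellTerm n k g (fun i => X i ω) ∂P =
      ENNReal.ofReal lam * volume (cell n ⁻¹' {k}) *
        voidLaplace lam (‖corner n k‖ + margin n) g := by
  classical
  set C := cell n ⁻¹' {k}
  have hC : MeasurableSet C := measurable_cell n (measurableSet_singleton k)
  have hCr : ∀ y ∈ C, ‖y‖ ≤ ‖corner n k‖ + margin n := fun y hy => by
    rw [← show cell n y = k from hy]
    exact norm_le_corner_add_margin n y
  have hv : volume C ≠ ⊤ := ne_top_of_le_ne_top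
    (measure_closedBall_lt_top (x := (0 : Plane)) (r := ‖corner n k‖ + margin n)).ne
    (measure_mono fun y hy => by simpa using hCr y hy)
  set r := ‖corner n k‖ + margin n
  have hm : Measurable fun y => if y ∈ C then 0 else killDisk r g y :=
    Measurable.ite hC measurable_const (measurable_killDisk _ hg)
  have h := laplace_functional hlam hX hC (({1} : Set ℕ∞).indicator 1)
    (fun m => by by_cases hm : m ∈ ({1} : Set ℕ∞) <;> simp [hm]) hm (fun x hx => by simp [hx])
  have hsplit : ∀ y, 1 - expNeg (killDisk r g y) =
      C.indicator 1 y + (1 - expNeg (if y ∈ C then 0 else killDisk r g y)) := by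
    intro y
    by_cases hy : y ∈ C
    · simp [hy, killDisk, hCr y hy]
    · simp [hy]
  have hint : ∫⁻ y, (1 - expNeg (killDisk r g y)) = volume C +
      ∫⁻ y, (1 - expNeg (if y ∈ C then 0 else killDisk r g y)) := by
    simp only [hsplit]
    rw [lintegral_add_left (measurable_one.indicator hC), lintegral_indicator_one hC]
  rw [voidLaplace, hint, mul_add, expNeg_add, ← mul_assoc,
    ← lintegral_indicator_pointCount_eq_one hlam hX hC hv, ← h]
  rfl

/-- Any other point in the disk would make the exponent infinite and the term zero. So the single
point of the square is nearest to the origin, with a gap of at least 1/(n + 1). -/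
lemma cellTerm_ne_zero {n : ℕ} {k : ℤ × ℤ} {g : Plane → ℝ≥0∞} {x : ℕ → Plane}
    (h : cellTerm n k g x ≠ 0) :
    ∃ i, cell n (x i) = k ∧ ‖x i‖ + 1 / (n + 1) ≤ ‖corner n k‖ + margin n ∧
      ∀ j, j ≠ i → ‖corner n k‖ + margin n < ‖x j‖ := by
  classical
  obtain ⟨h1, h2⟩ := mul_ne_zero_iff.1 h
  have h1' : pointCount x (cell n ⁻¹' {k}) = 1 := by
    by_contra hne
    exact h1 (indicator_of_notMem (by simpa using hne) _)
  obtain ⟨i, hi⟩ := encard_eq_one.1 h1'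
  have hik : cell n (x i) = k := by
    have : i ∈ {i : ℕ | x i ∈ cell n ⁻¹' {k}} := by rw [hi]; rfl
    exact this
  refine ⟨i, hik, hik ▸ norm_lt_corner_add_margin n (x i), fun j hj => ?_⟩
  have hjk : x j ∉ cell n ⁻¹' {k} := fun hjk => hj (by
    have : j ∈ {i : ℕ | x i ∈ cell n ⁻¹' {k}} := hjk
    rw [hi] at this
    exact this)
  by_contra hle
  refine h2 ?_
  rw [ENNReal.tsum_eq_top_of_eq_top ⟨j, ?_⟩, expNeg_top]
  rw [if_neg hjk, killDisk, if_pos (not_lt.1 hle)]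

lemma cellTerm_le_one (n : ℕ) (k : ℤ × ℤ) (g : Plane → ℝ≥0∞) (x : ℕ → Plane) :
    cellTerm n k g x ≤ 1 := by
  refine mul_le_one' ?_ (expNeg_le_one _)
  by_cases h : pointCount x (cell n ⁻¹' {k}) ∈ ({1} : Set ℕ∞) <;> simp [h]

/-- Two different selected points would each be strictly farther from the origin than the other. -/
lemma eq_of_cellTerm_ne_zero {n : ℕ} {k k' : ℤ × ℤ} {g g' : Plane → ℝ≥0∞} {x : ℕ → Plane}
    (h : cellTerm n k g x ≠ 0) (h' : cellTerm n k' g' x ≠ 0) : k = k' := by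
  obtain ⟨i, hi, hir, hij⟩ := cellTerm_ne_zero h
  obtain ⟨i', hi', hir', hij'⟩ := cellTerm_ne_zero h'
  by_cases hii : i = i'
  · rw [← hi, ← hi', hii]
  · have h1 := hij i' (Ne.symm hii)
    have h2 := hij' i hii
    have : (0 : ℝ) < 1 / (n + 1) := by positivity
    linarith

/-- At most one square contributes; the bound 1 serves for dominated convergence. -/
lemma tsum_cellTerm_le_one (n : ℕ) {f : Plane → ℝ≥0∞} (hf : ∀ x, f x ≤ 1)
    (G : Plane → Plane → ℝ≥0∞) (x : ℕ → Plane) :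
    ∑' k, f (corner n k) * cellTerm n k (G (corner n k)) x ≤ 1 := by
  by_cases h : ∃ k, cellTerm n k (G (corner n k)) x ≠ 0
  · obtain ⟨k, hk⟩ := h
    rw [tsum_eq_single k]
    · exact mul_le_one' (hf _) (cellTerm_le_one _ _ _ _)
    · intro k' hk'
      by_contra hne
      exact hk' (eq_of_cellTerm_ne_zero (mul_ne_zero_iff.1 hne).2 hk)
  · push Not at h
    simp [h]

/-- The point `x b` is the nearest one to the origin, with a positive gap to the others. -/
def IsStrictNearest (x : ℕ → Plane) (b : ℕ) : Prop := ∃ δ > 0, ∀ j, j ≠ b → ‖x b‖ + δ ≤ ‖x j‖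

lemma IsStrictNearest.nearestIndex_eq {x : ℕ → Plane} {b : ℕ} (h : IsStrictNearest x b) :
    nearestIndex x = b := by
  obtain ⟨δ, hδ, h⟩ := h
  have : {i : ℕ | ∀ j, ‖x i‖ ≤ ‖x j‖} = {b} := by
    ext i
    simp only [mem_ofPred_eq, mem_singleton_iff]
    constructor
    · intro hi
      by_contra hne
      linarith [h i hne, hi b]
    · rintro rfl j
      by_cases hj : j = i
      · rw [hj]
      · linarith [h j hj]
  rw [nearestIndex, this, csInf_singleton]

-- The disk attached to the square of `x b` has radius at most ‖x b‖ + 2 `margin n`, which is below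
-- the norms of all other points; and no other square can be selected.
open Classical in
lemma IsStrictNearest.tsum_cellTerm_eq {x : ℕ → Plane} {b : ℕ} {δ : ℝ}
    (h : ∀ j, j ≠ b → ‖x b‖ + δ ≤ ‖x j‖) {n : ℕ} (hn : 3 * margin n < δ) (f : Plane → ℝ≥0∞)
    (G : Plane → Plane → ℝ≥0∞) :
    ∑' k, f (corner n k) * cellTerm n k (G (corner n k)) x =
      f (corner n (cell n (x b))) *
        expNeg (∑' j, if j = b then 0 else G (corner n (cell n (x b))) (x j)) := by
  have hmp := margin_pos n
  have hn1 : (0 : ℝ) < 1 / (n + 1) := by positivity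
  have hgap : ∀ j, j ≠ b → ‖corner n (cell n (x b))‖ + margin n < ‖x j‖ := fun j hj => by
    linarith [h j hj, norm_corner_le n (x b)]
  have hcell : ∀ j, x j ∈ cell n ⁻¹' {cell n (x b)} ↔ j = b := by
    intro j
    constructor
    · intro hj
      by_contra hne
      have h1 := norm_le_corner_add_margin n (x j)
      rw [show cell n (x j) = cell n (x b) from hj] at h1
      linarith [hgap j hne]
    · rintro rfl
      rfl
  rw [tsum_eq_single (cell n (x b))]
  · congr 1
    have h1 : pointCount x (cell n ⁻¹' {cell n (x b)}) = 1 := by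
      rw [pointCount]
      simp only [hcell, ofPred_eq_eq_singleton, encard_singleton]
    rw [cellTerm, h1]
    simp only [mem_singleton_iff, indicator_of_mem, Pi.one_apply, one_mul, hcell]
    congr 1
    refine tsum_congr fun j => ?_
    split_ifs with hj
    · rfl
    · rw [killDisk, if_neg (not_le.2 (hgap j hj))]
  · intro k hk
    by_contra hne
    obtain ⟨i, hi, hir, hij⟩ := cellTerm_ne_zero (mul_ne_zero_iff.1 hne).2
    have hib : b ≠ i := by
      rintro rfl
      exact hk hi.symm
    have := hij b hib
    linarith [h i hib.symm]

/-- The sum over squares, weighted by their areas, is the integral of a function constant on each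
square, that is, an integral against the image of Lebesgue measure under `cell n`. -/
lemma lintegral_tsum_cellTerm [IsProbabilityMeasure P] (hlam : 0 < lam)
    (hX : IsHomogeneousPPP P lam X) (n : ℕ) (f : Plane → ℝ≥0∞)
    {G : Plane → Plane → ℝ≥0∞} (hG : ∀ c, Measurable (G c)) :
    ∫⁻ ω, ∑' k, f (corner n k) * cellTerm n k (G (corner n k)) (fun i => X i ω) ∂P =
      ENNReal.ofReal lam * ∫⁻ x, f (corner n (cell n x)) *
        voidLaplace lam (‖corner n (cell n x)‖ + margin n) (G (corner n (cell n x))) := by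
  rw [lintegral_tsum fun k => ((measurable_cellTerm hX n k (hG _)).const_mul _).aemeasurable,
    ← lintegral_map (f := fun k => f (corner n k) *
        voidLaplace lam (‖corner n k‖ + margin n) (G (corner n k)))
      (measurable_of_countable _) (measurable_cell n), lintegral_countable',
    ← ENNReal.tsum_mul_left]
  refine tsum_congr fun k => ?_
  rw [lintegral_const_mul _ (measurable_cellTerm hX n k (hG _)), lintegral_cellTerm hlam hX n k (hG _),
    Measure.map_apply (measurable_cell n) (measurableSet_singleton k)]
  ring

end

/-! ### Limits as the mesh tends to zero -/

section

lemma one_sub_expNeg_le (s : ℝ≥0∞) : 1 - expNeg s ≤ min 1 s := by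
  refine le_min tsub_le_self ?_
  rcases eq_or_ne s ⊤ with rfl | hs
  · simp
  · rw [← ENNReal.ofReal_toReal hs, expNeg_ofReal ENNReal.toReal_nonneg, ← ENNReal.ofReal_one,
      ← ENNReal.ofReal_sub _ (Real.exp_nonneg _)]
    refine ENNReal.ofReal_le_ofReal ?_
    linarith [Real.add_one_le_exp (-s.toReal)]

lemma min_one_mul_le (A : ℝ≥0) (s : ℝ≥0∞) : min 1 (A * s) ≤ (1 + A) * min 1 s := by
  rcases le_total 1 s with h | h
  · rw [min_eq_left h, mul_one]
    exact (min_le_left _ _).trans le_self_add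
  · rw [min_eq_right h]
    refine (min_le_right _ _).trans ?_
    gcongr
    exact le_add_self

/-- Only finitely many terms are at least 1, and each of them is finite. -/
lemma tsum_ne_top_of_tsum_min {g : ℕ → ℝ≥0∞} (hg : ∀ j, g j ≠ ⊤)
    (h : ∑' j, min 1 (g j) ≠ ⊤) : ∑' j, g j ≠ ⊤ := by
  have hfin := ENNReal.finite_const_le_of_tsum_ne_top h one_ne_zero
  have hle : ∀ j, g j ≤ min 1 (g j) + (hfin.toFinset : Set ℕ).indicator g j := by
    intro j
    by_cases hj : 1 ≤ g j
    · rw [indicator_of_mem (by simpa using hj)]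
      exact le_add_self
    · rw [min_eq_right (not_le.1 hj).le]
      exact le_self_add
  refine ne_top_of_le_ne_top ?_ (ENNReal.tsum_le_tsum hle)
  rw [ENNReal.tsum_add, ← sum_eq_tsum_indicator]
  exact ENNReal.add_ne_top.2 ⟨h, ENNReal.sum_ne_top.2 fun j _ => hg j⟩

variable {Ω : Type*} [MeasurableSpace Ω] {P : Measure Ω} {lam : ℝ} {X : ℕ → Ω → Plane}

/-- Campbell's theorem is applied to min(1, φ), since φ may have a non-integrable pole, as the path
gain does at the user. -/
lemma ae_tsum_ne_top (hlam : 0 < lam) (hX : IsHomogeneousPPP P lam X)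
    {φ : Plane → ℝ≥0∞} (hφm : Measurable φ) (hφt : ∀ y, φ y ≠ ⊤)
    (hφi : ∫⁻ y, min 1 (φ y) ≠ ⊤) : ∀ᵐ ω ∂P, ∑' j, φ (X j ω) ≠ ⊤ := by
  have hm : Measurable fun y => min 1 (φ y) := measurable_const.min hφm
  have h := lintegral_tsum_points hlam hX hm
  have h2 : ∫⁻ ω, ∑' j, min 1 (φ (X j ω)) ∂P ≠ ⊤ := by
    rw [h]
    exact ENNReal.mul_ne_top ENNReal.ofReal_ne_top hφi
  filter_upwards [ae_lt_top (Measurable.tsum fun j => hm.comp (hX.measurable j)) h2] with ω hω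
  exact tsum_ne_top_of_tsum_min (fun j => hφt _) hω.ne

/-- The approximating radii are never below ‖x‖, so every point of the closed disk, boundary
included, stays killed; a point outside is eventually released. -/
lemma tendsto_killDisk {x : Plane} {G : Plane → Plane → ℝ≥0∞} {y : Plane}
    (hGc : Continuous fun c => G c y) :
    Tendsto (fun n => killDisk (‖corner n (cell n x)‖ + margin n) (G (corner n (cell n x))) y)
      atTop (𝓝 (killDisk ‖x‖ (G x) y)) := by
  by_cases hy : ‖y‖ ≤ ‖x‖
  · rw [killDisk, if_pos hy]
    refine tendsto_const_nhds.congr fun n => ?_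
    rw [killDisk, if_pos (hy.trans (norm_le_corner_add_margin n x))]
  · rw [killDisk, if_neg hy]
    have hlim : Tendsto (fun n => ‖corner n (cell n x)‖ + margin n) atTop (𝓝 ‖x‖) := by
      simpa using (tendsto_corner x).norm.add tendsto_margin
    refine ((hGc.tendsto x).comp (tendsto_corner x)).congr' ?_
    filter_upwards [hlim.eventually (gt_mem_nhds (not_le.1 hy))] with n hn
    rw [killDisk, if_neg (not_le.2 hn), Function.comp]

/-- Domination: on the killed disks, eventually inside the ball of radius ‖x‖ + 1, the integrand is
at most 1; elsewhere 1 - exp(-G) ≤ min(1, Aφ) ≤ (1 + A) min(1, φ). -/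
lemma tendsto_voidLaplace {G : Plane → Plane → ℝ≥0∞} (hGm : ∀ c, Measurable (G c))
    (hGc : ∀ y, Continuous fun c => G c y) {φ : Plane → ℝ≥0∞} (hφm : Measurable φ)
    (hφi : ∫⁻ y, min 1 (φ y) ≠ ⊤)
    (hGb : ∀ x, ∃ A : ℝ≥0, ∀ᶠ c in 𝓝 x, ∀ y, G c y ≤ A * φ y) (lam : ℝ) (x : Plane) :
    Tendsto (fun n => voidLaplace lam (‖corner n (cell n x)‖ + margin n) (G (corner n (cell n x))))
      atTop (𝓝 (voidLaplace lam ‖x‖ (G x))) := by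
  obtain ⟨A, hA⟩ := hGb x
  refine (continuous_expNeg.tendsto _).comp
    (ENNReal.Tendsto.const_mul ?_ (Or.inr ENNReal.ofReal_ne_top))
  have hlim : Tendsto (fun n => ‖corner n (cell n x)‖ + margin n) atTop (𝓝 ‖x‖) := by
    simpa using (tendsto_corner x).norm.add tendsto_margin
  have hm : Measurable fun y => min 1 (φ y) := measurable_const.min hφm
  refine tendsto_lintegral_filter_of_dominated_convergence
    (fun y => (Metric.closedBall (0 : Plane) (‖x‖ + 1)).indicator 1 y + (1 + A) * min 1 (φ y))
    (Eventually.of_forall fun n => measurable_const.sub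
      (measurable_expNeg.comp (measurable_killDisk _ (hGm _)))) ?_ ?_ (ae_of_all _ fun y => ?_)
  · filter_upwards [(tendsto_corner x).eventually hA,
      hlim.eventually (gt_mem_nhds (lt_add_one ‖x‖))] with n hn hr
    refine ae_of_all _ fun y => ?_
    by_cases hy : ‖y‖ ≤ ‖corner n (cell n x)‖ + margin n
    · rw [indicator_of_mem (by simpa using hy.trans hr.le)]
      exact tsub_le_self.trans le_self_add
    · rw [killDisk, if_neg hy]
      refine le_trans ?_ le_add_self
      refine (one_sub_expNeg_le _).trans ((min_le_min_left 1 (hn y)).trans (min_one_mul_le A _))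
  · rw [lintegral_add_left (measurable_one.indicator measurableSet_closedBall),
      lintegral_indicator_one measurableSet_closedBall, lintegral_const_mul _ hm]
    exact ENNReal.add_ne_top.2 ⟨measure_closedBall_lt_top.ne,
      ENNReal.mul_ne_top (ENNReal.add_ne_top.2 ⟨ENNReal.one_ne_top, ENNReal.coe_ne_top⟩) hφi⟩
  · exact ENNReal.Tendsto.sub tendsto_const_nhds
      ((continuous_expNeg.tendsto _).comp (tendsto_killDisk (hGc y))) (Or.inl ENNReal.one_ne_top)

lemma tendsto_lintegral_voidLaplace (hlam : 0 < lam) {f : Plane → ℝ≥0∞} (hfc : Continuous f)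
    (hf : ∀ x, f x ≤ 1)
    {G : Plane → Plane → ℝ≥0∞} (hGm : ∀ c, Measurable (G c))
    (hGc : ∀ y, Continuous fun c => G c y) {φ : Plane → ℝ≥0∞} (hφm : Measurable φ)
    (hφi : ∫⁻ y, min 1 (φ y) ≠ ⊤)
    (hGb : ∀ x, ∃ A : ℝ≥0, ∀ᶠ c in 𝓝 x, ∀ y, G c y ≤ A * φ y) :
    Tendsto (fun n => ENNReal.ofReal lam * ∫⁻ x, f (corner n (cell n x)) *
        voidLaplace lam (‖corner n (cell n x)‖ + margin n) (G (corner n (cell n x))))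
      atTop (𝓝 (ENNReal.ofReal lam * ∫⁻ x, f x * voidLaplace lam ‖x‖ (G x))) := by
  refine ENNReal.Tendsto.const_mul ?_ (Or.inr ENNReal.ofReal_ne_top)
  refine tendsto_lintegral_of_dominated_convergence (fun x => voidLaplace lam ‖x‖ 0)
    (fun n => ?_) (fun n => ae_of_all _ fun x => ?_) ?_ (ae_of_all _ fun x => ?_)
  · exact (measurable_of_countable fun k => f (corner n k) *
      voidLaplace lam (‖corner n k‖ + margin n) (G (corner n k))).comp (measurable_cell n)
  -- The discretised radius is at least ‖x‖, so the Gaussian at x itself dominates.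
  · refine (mul_le_of_le_one_left zero_le (hf _)).trans ((voidLaplace_le _ _ _).trans ?_)
    have h := norm_le_corner_add_margin n x
    change _ ≤ voidLaplace lam ‖x‖ 0
    rw [voidLaplace_zero hlam (norm_nonneg x), voidLaplace_zero hlam ((norm_nonneg x).trans h)]
    gcongr
  · have h := lintegral_voidLaplace_zero hlam
    intro h'
    rw [h', ENNReal.mul_top (by simpa using hlam)] at h
    exact ENNReal.top_ne_one h
  · refine ENNReal.Tendsto.mul ((hfc.tendsto x).comp (tendsto_corner x)) (Or.inr ?_)
      (tendsto_voidLaplace hGm hGc hφm hφi hGb lam x) (Or.inr ?_)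
    · exact expNeg_ne_top _
    · exact ne_top_of_le_ne_top ENNReal.one_ne_top (hf x)

end

/-! ### Existence and law of the nearest point -/

section
variable {Ω : Type*} [MeasurableSpace Ω] {P : Measure Ω} {lam : ℝ} {X : ℕ → Ω → Plane}

/-- The expected number of selected squares tends to λ ∫ exp(-λπ‖x‖²) dx = 1, and any selected
square exhibits a strict nearest point. Existence and absence of ties come together. -/
lemma ae_exists_isStrictNearest [IsProbabilityMeasure P] (hlam : 0 < lam)
    (hX : IsHomogeneousPPP P lam X) : ∀ᵐ ω ∂P, ∃ b, IsStrictNearest (fun i => X i ω) b := by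
  let F : ℕ → Ω → ℝ≥0∞ := fun n ω =>
    ∑' k, (fun _ : Plane => (1 : ℝ≥0∞)) (corner n k) * cellTerm n k
      ((fun _ => 0 : Plane → Plane → ℝ≥0∞) (corner n k)) (fun i => X i ω)
  have hFm : ∀ n, Measurable (F n) := fun n =>
    Measurable.tsum fun k => (measurable_cellTerm hX n k measurable_zero).const_mul _
  have hF1 : ∀ n ω, F n ω ≤ 1 := fun n ω =>
    tsum_cellTerm_le_one n (f := fun _ => 1) (fun _ => le_rfl) (fun _ => 0) fun i => X i ω
  have hlim : Tendsto (fun n => ∫⁻ ω, F n ω ∂P) atTop (𝓝 1) := by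
    have h := tendsto_lintegral_voidLaplace hlam (f := fun _ => 1) continuous_const
      (fun _ => le_rfl) (G := fun _ => 0) (fun _ => measurable_zero) (fun _ => continuous_const)
      (φ := 0) measurable_zero (by simp) (fun x => ⟨0, by simp⟩)
    simp only [one_mul] at h
    rw [lintegral_voidLaplace_zero hlam] at h
    refine h.congr fun n => ?_
    have := lintegral_tsum_cellTerm hlam hX n (fun _ => 1) (G := fun _ => 0)
      (fun _ => measurable_zero)
    simp only [one_mul] at this
    simp only [F, one_mul]
    exact this.symm
  have hA : MeasurableSet (⋃ n, {ω | F n ω ≠ 0}) :=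
    MeasurableSet.iUnion fun n => (hFm n) (measurableSet_singleton 0).compl
  have hP : P (⋃ n, {ω | F n ω ≠ 0}) = 1 := by
    refine le_antisymm prob_le_one (le_of_tendsto' hlim fun n => ?_)
    refine le_trans ?_ (measure_mono (subset_iUnion _ n))
    refine (lintegral_mono fun ω => ?_).trans (lintegral_indicator_one_le _)
    by_cases h : F n ω = 0
    · simp [h]
    · rw [indicator_of_mem (by exact h)]
      exact hF1 n ω
  have hae : ∀ᵐ ω ∂P, ω ∈ ⋃ n, {ω | F n ω ≠ 0} := (prob_compl_eq_zero_iff hA).2 hP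
  filter_upwards [hae] with ω hω
  obtain ⟨n, hn⟩ := mem_iUnion.1 hω
  obtain ⟨k, hk⟩ : ∃ k, cellTerm n k 0 (fun i => X i ω) ≠ 0 := by
    by_contra! hk
    refine hn ?_
    simp only [F, one_mul]
    exact ENNReal.tsum_eq_zero.2 hk
  obtain ⟨i, -, hi, hj⟩ := cellTerm_ne_zero hk
  exact ⟨i, 1 / (n + 1), by positivity, fun j hji => hi.trans (hj j hji).le⟩

end

section
variable {Ω : Type*} [MeasurableSpace Ω] {P : Measure Ω} {lam : ℝ} {X : ℕ → Ω → Plane}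

open Classical in
/-- The law of a Poisson process seen from its nearest point to the origin: given that this point
is `x`, the other points form a Poisson process outside the disk of radius `‖x‖`. -/
theorem lintegral_nearest [IsProbabilityMeasure P] (hlam : 0 < lam)
    (hX : IsHomogeneousPPP P lam X) {f : Plane → ℝ≥0∞} (hfc : Continuous f) (hf : ∀ x, f x ≤ 1)
    {G : Plane → Plane → ℝ≥0∞} (hGm : ∀ c, Measurable (G c))
    (hGc : ∀ y, Continuous fun c => G c y) {φ : Plane → ℝ≥0∞} (hφm : Measurable φ)
    (hφt : ∀ y, φ y ≠ ⊤) (hφi : ∫⁻ y, min 1 (φ y) ≠ ⊤)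
    (hGb : ∀ x, ∃ A : ℝ≥0, ∀ᶠ c in 𝓝 x, ∀ y, G c y ≤ A * φ y) :
    ∫⁻ ω, f (X (nearestIndex fun i => X i ω) ω) *
        expNeg (∑' j, if j = nearestIndex fun i => X i ω then 0 else
          G (X (nearestIndex fun i => X i ω) ω) (X j ω)) ∂P =
      ENNReal.ofReal lam * ∫⁻ x, f x * voidLaplace lam ‖x‖ (G x) := by
  have hR := tendsto_lintegral_voidLaplace hlam hfc hf hGm hGc hφm hφi hGb
  -- For each mesh the two sides are linked by an exact identity; the limit of the integral side is
  -- `hR`, so the point side remains.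
  suffices hL : Tendsto (fun n => ∫⁻ ω, ∑' k, f (corner n k) *
      cellTerm n k (G (corner n k)) (fun i => X i ω) ∂P) atTop
      (𝓝 (∫⁻ ω, f (X (nearestIndex fun i => X i ω) ω) *
        expNeg (∑' j, if j = nearestIndex fun i => X i ω then 0 else
          G (X (nearestIndex fun i => X i ω) ω) (X j ω)) ∂P)) by
    simp only [lintegral_tsum_cellTerm hlam hX _ f hGm] at hL
    exact tendsto_nhds_unique hL hR
  refine tendsto_lintegral_of_dominated_convergence (fun _ => 1) (fun n => ?_)
    (fun n => ae_of_all _ fun ω => ?_) (by simp) ?_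
  · exact Measurable.tsum fun k => (measurable_cellTerm hX n k (hGm _)).const_mul _
  · exact tsum_cellTerm_le_one n hf G fun i => X i ω
  filter_upwards [ae_exists_isStrictNearest hlam hX, ae_tsum_ne_top hlam hX hφm hφt hφi]
    with ω ⟨b, hb⟩ hsum
  rw [hb.nearestIndex_eq]
  obtain ⟨δ, hδ, hbj⟩ := hb
  have hc := tendsto_corner (X b ω)
  have hlim : Tendsto (fun n => f (corner n (cell n (X b ω))) *
        expNeg (∑' j, if j = b then 0 else G (corner n (cell n (X b ω))) (X j ω))) atTop
      (𝓝 (f (X b ω) * expNeg (∑' j, if j = b then 0 else G (X b ω) (X j ω)))) := by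
    refine ENNReal.Tendsto.mul ((hfc.tendsto _).comp hc) (Or.inr (expNeg_ne_top _)) ?_
      (Or.inr (ne_top_of_le_ne_top ENNReal.one_ne_top (hf _)))
    refine (continuous_expNeg.tendsto _).comp ?_
    obtain ⟨A, hA⟩ := hGb (X b ω)
    refine tendsto_tsum_of_dominated (b := fun j => A * φ (X j ω)) ?_ ?_ fun j => ?_
    · rw [ENNReal.tsum_mul_left]
      exact ENNReal.mul_ne_top ENNReal.coe_ne_top hsum
    · filter_upwards [hc.eventually hA] with n hn j
      split_ifs
      · exact zero_le
      · exact hn _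
    · split_ifs
      · exact tendsto_const_nhds
      · exact ((hGc _).tendsto _).comp hc
  -- Once the mesh is small compared with the gap δ, the sum over squares reduces to the square of
  -- the nearest point.
  refine hlim.congr' ?_
  have h3 : Tendsto (fun n => 3 * margin n) atTop (𝓝 0) := by
    simpa using tendsto_margin.const_mul 3
  filter_upwards [h3.eventually (gt_mem_nhds hδ)] with n hn
  exact (IsStrictNearest.tsum_cellTerm_eq (x := fun i => X i ω) hbj hn f G).symm

end

/-! ### Exponential fading -/

section

lemma lintegral_expMeasure {f : ℝ → ℝ≥0∞} (hf : Measurable f) :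
    ∫⁻ x, f x ∂(expMeasure 1) = ∫⁻ x in Ioi 0, ENNReal.ofReal (Real.exp (-x)) * f x := by
  have hm : Measurable (gammaPDF 1 1) := (measurable_exponentialPDFReal 1).ennreal_ofReal
  rw [expMeasure, gammaMeasure, lintegral_withDensity_eq_lintegral_mul _ hm hf,
    ← lintegral_add_compl _ (measurableSet_Ici (a := (0 : ℝ))), compl_Ici,
    setLIntegral_congr_fun (g := 0) measurableSet_Iio fun x hx => by
      simp [gammaPDF_of_neg (mem_Iio.1 hx)]]
  simp only [Pi.zero_apply, lintegral_zero, add_zero]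
  rw [setLIntegral_congr Ioi_ae_eq_Ici.symm]
  refine setLIntegral_congr_fun measurableSet_Ioi fun x hx => ?_
  have := exponentialPDF_of_nonneg (r := 1) (le_of_lt (mem_Ioi.1 hx))
  rw [one_mul, one_mul] at this
  rw [Pi.mul_apply, ← this]
  rfl

lemma lintegral_Ioi_exp_mul {a : ℝ} (ha : 0 < a) (c : ℝ) :
    ∫⁻ x in Ioi c, ENNReal.ofReal (Real.exp (-a * x)) =
      ENNReal.ofReal (Real.exp (-a * c) / a) := by
  rw [← ofReal_integral_eq_lintegral_ofReal (integrableOn_exp_mul_Ioi (by linarith) c)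
    (ae_of_all _ fun x => (Real.exp_pos _).le), integral_exp_mul_Ioi (by linarith), neg_div_neg_eq]

lemma expMeasure_lt_ofReal (T : ℝ≥0∞) : expMeasure 1 {x | T < ENNReal.ofReal x} = expNeg T := by
  rcases eq_or_ne T ⊤ with rfl | hT
  · simp
  have hset : {x : ℝ | T < ENNReal.ofReal x} = Ioi T.toReal := by
    ext x
    simp [ENNReal.lt_ofReal_iff_toReal_lt hT]
  rw [hset, ← lintegral_indicator_one measurableSet_Ioi,
    lintegral_expMeasure (measurable_one.indicator measurableSet_Ioi)]
  have h : ∀ x : ℝ, ENNReal.ofReal (Real.exp (-x)) * (Ioi T.toReal).indicator 1 x =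
      (Ioi T.toReal).indicator (fun x => ENNReal.ofReal (Real.exp (-1 * x))) x := by
    intro x
    by_cases hx : x ∈ Ioi T.toReal <;> simp [hx]
  simp only [h]
  rw [lintegral_indicator measurableSet_Ioi, Measure.restrict_restrict measurableSet_Ioi,
    inter_eq_left.2 (Ioi_subset_Ioi ENNReal.toReal_nonneg), lintegral_Ioi_exp_mul one_pos, div_one,
    neg_one_mul, ← expNeg_ofReal ENNReal.toReal_nonneg, ENNReal.ofReal_toReal hT]

lemma lintegral_expNeg_expMeasure {c : ℝ} (hc : 0 ≤ c) :
    ∫⁻ x, expNeg (ENNReal.ofReal (c * x)) ∂(expMeasure 1) =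
      expNeg (ENNReal.ofReal (Real.log (1 + c))) := by
  rw [lintegral_expMeasure (by fun_prop), expNeg_log hc]
  have h : ∫⁻ x in Ioi (0 : ℝ), ENNReal.ofReal (Real.exp (-x)) * expNeg (ENNReal.ofReal (c * x)) =
      ∫⁻ x in Ioi (0 : ℝ), ENNReal.ofReal (Real.exp (-(1 + c) * x)) := by
    refine setLIntegral_congr_fun measurableSet_Ioi fun x hx => ?_
    have hx : 0 < x := hx
    rw [expNeg_ofReal (by positivity), ← ENNReal.ofReal_mul (by positivity), ← Real.exp_add]
    ring_nf
  rw [h, lintegral_Ioi_exp_mul (by linarith)]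
  simp

lemma lintegral_ofReal_expMeasure_ne_top : ∫⁻ x, ENNReal.ofReal x ∂(expMeasure 1) ≠ ⊤ := by
  rw [lintegral_expMeasure (by fun_prop)]
  have h := Real.GammaIntegral_convergent (s := 2) two_pos
  have h2 := h.lintegral_lt_top
  refine ne_of_eq_of_ne (setLIntegral_congr_fun measurableSet_Ioi fun x _ => ?_) h2.ne
  rw [← ENNReal.ofReal_mul (Real.exp_pos _).le]
  norm_num

lemma measurable_threshold {Ω : Type*} {m : MeasurableSpace Ω} {h : ℕ → Ω → ℝ} {i : ℕ}
    (hm : ∀ j, j ≠ i → Measurable (h j)) (a : ℝ≥0∞) (c : ℕ → ℝ) :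
    Measurable fun ω => a + ∑' j, (if j = i then 0 else ENNReal.ofReal (c j * h j ω)) := by
  refine Measurable.const_add (Measurable.tsum fun j => ?_) a
  split_ifs with hj
  · exact measurable_const
  · exact ((hm j hj).const_mul (c j)).ennreal_ofReal

variable {Ω : Type*} [MeasurableSpace Ω] {P : Measure Ω}

/-- Fubini for the product law: it allows `Y` to be frozen while averaging over `Z`. -/
lemma lintegral_of_indepFun [IsProbabilityMeasure P] {α γ : Type*} [MeasurableSpace α] [MeasurableSpace γ] {Y : Ω → α}
    {Z : Ω → γ} (hY : Measurable Y) (hZ : Measurable Z) (h : IndepFun Y Z P)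
    {Φ : α × γ → ℝ≥0∞} (hΦ : Measurable Φ) :
    ∫⁻ ω, Φ (Y ω, Z ω) ∂P = ∫⁻ ω', ∫⁻ ω, Φ (Y ω', Z ω) ∂P ∂P := by
  have := Measure.isProbabilityMeasure_map (μ := P) hY.aemeasurable
  have := Measure.isProbabilityMeasure_map (μ := P) hZ.aemeasurable
  rw [← lintegral_map hΦ (hY.prodMk hZ),
    (indepFun_iff_map_prod_eq_prod_map_map hY.aemeasurable hZ.aemeasurable).1 h,
    lintegral_prod _ hΦ.aemeasurable, lintegral_map hΦ.lintegral_prod_right' hY]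
  exact lintegral_congr fun ω' => lintegral_map (hΦ.comp measurable_prodMk_left) hZ

variable {h : ℕ → Ω → ℝ}

lemma ae_nonneg_of_hasLaw (hlaw : ∀ j, HasLaw (h j) (expMeasure 1) P) : ∀ᵐ ω ∂P, ∀ j, 0 ≤ h j ω := by
  rw [ae_all_iff]
  intro j
  have := isProbabilityMeasure_expMeasure one_pos
  have h1 : ∀ᵐ x ∂(expMeasure 1), (0 : ℝ) < x := by
    have hset : {x : ℝ | (0 : ℝ≥0∞) < ENNReal.ofReal x} = Ioi 0 := by ext x; simp
    have h2 := expMeasure_lt_ofReal 0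
    rw [hset, expNeg_zero] at h2
    exact (prob_compl_eq_zero_iff measurableSet_Ioi).2 h2
  rw [← (hlaw j).map_eq] at h1
  filter_upwards [ae_of_ae_map (hlaw j).aemeasurable h1] with ω hω using hω.le

/-- Partial sums factor by independence; dominated convergence with bound 1 passes to the series,
even a divergent one. -/
lemma lintegral_expNeg_tsum [IsProbabilityMeasure P] (hm : ∀ j, Measurable (h j))
    (hlaw : ∀ j, HasLaw (h j) (expMeasure 1) P) (hind : iIndepFun h P) {c : ℕ → ℝ}
    (hc : ∀ j, 0 ≤ c j) :
    ∫⁻ ω, expNeg (∑' j, ENNReal.ofReal (c j * h j ω)) ∂P =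
      expNeg (∑' j, ENNReal.ofReal (Real.log (1 + c j))) := by
  have hψ : ∀ j, Measurable fun x => expNeg (ENNReal.ofReal (c j * x)) := fun j => by fun_prop
  have h1 : ∀ n, ∫⁻ ω, expNeg (∑ j ∈ Finset.range n, ENNReal.ofReal (c j * h j ω)) ∂P =
      expNeg (∑ j ∈ Finset.range n, ENNReal.ofReal (Real.log (1 + c j))) := by
    intro n
    simp only [expNeg_sum]
    refine (lintegral_prod_eq_prod_lintegral_of_indepFun (Finset.range n) _
      (hind.comp _ hψ) fun j => (hψ j).comp (hm j)).trans (Finset.prod_congr rfl fun j _ => ?_)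
    rw [← lintegral_expNeg_expMeasure (hc j), ← (hlaw j).map_eq, lintegral_map (hψ j) (hm j)]
    rfl
  refine tendsto_nhds_unique (f := fun n => ∫⁻ ω, expNeg (∑ j ∈ Finset.range n,
    ENNReal.ofReal (c j * h j ω)) ∂P) (l := atTop) ?_ ?_
  · refine tendsto_lintegral_of_dominated_convergence (fun _ => 1) (fun n => ?_)
      (fun n => ae_of_all _ fun ω => expNeg_le_one _) (by simp) (ae_of_all _ fun ω => ?_)
    · fun_prop
    · exact (continuous_expNeg.tendsto _).comp (ENNReal.tendsto_nat_tsum _)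
  · simp only [h1]
    exact (continuous_expNeg.tendsto _).comp (ENNReal.tendsto_nat_tsum _)

/-- Coverage probability for Rayleigh fading: the threshold depends on the other fading
variables. -/
lemma measure_lt_fading [IsProbabilityMeasure P] (hm : ∀ j, Measurable (h j))
    (hlaw : ∀ j, HasLaw (h j) (expMeasure 1) P) (hind : iIndepFun h P) (i : ℕ) (a : ℝ≥0∞)
    {c : ℕ → ℝ} (hc : ∀ j, 0 ≤ c j) :
    P {ω | a + ∑' j, (if j = i then 0 else ENNReal.ofReal (c j * h j ω)) < ENNReal.ofReal (h i ω)} =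
      expNeg a * expNeg (∑' j, if j = i then 0 else ENNReal.ofReal (Real.log (1 + c j))) := by
  set T : Ω → ℝ≥0∞ := fun ω => a + ∑' j, (if j = i then 0 else ENNReal.ofReal (c j * h j ω))
    with hTdef
  -- The threshold involves only the fadings of index other than `i`, so it is independent of `h i`.
  have hTm' : Measurable[⨆ j ∈ {j | j ≠ i}, MeasurableSpace.comap (h j) inferInstance] T :=
    measurable_threshold (fun j hj => Measurable.mono (comap_measurable (h j))
      (le_iSup₂_of_le (f := fun j (_ : j ∈ {j | j ≠ i}) =>
        MeasurableSpace.comap (h j) inferInstance) j hj le_rfl) le_rfl) a c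
  have hTm : Measurable T := measurable_threshold (fun j _ => hm j) a c
  have hTi : IndepFun T (h i) P := by
    have h1 := indep_iSup_of_disjoint (fun j => (hm j).comap_le) hind.iIndep
      (S := {j | j ≠ i}) (T := {i}) (by simp)
    rw [IndepFun_iff_Indep]
    refine indep_of_indep_of_le_left (indep_of_indep_of_le_right h1 ?_) hTm'.comap_le
    exact le_iSup₂_of_le (f := fun j (_ : j ∈ ({i} : Set ℕ)) =>
            MeasurableSpace.comap (h j) inferInstance) i rfl le_rfl
  have hS : MeasurableSet {p : ℝ≥0∞ × ℝ | p.1 < ENNReal.ofReal p.2} :=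
    measurableSet_lt measurable_fst measurable_snd.ennreal_ofReal
  have key := lintegral_of_indepFun hTm (hm i) hTi (measurable_one.indicator hS)
  have e1 : P {ω | T ω < ENNReal.ofReal (h i ω)} =
      ∫⁻ ω, {p : ℝ≥0∞ × ℝ | p.1 < ENNReal.ofReal p.2}.indicator 1 (T ω, h i ω) ∂P := by
    rw [← lintegral_indicator_one (measurableSet_lt hTm (hm i).ennreal_ofReal)]
    rfl
  have e2 : ∀ τ, ∫⁻ ω, {p : ℝ≥0∞ × ℝ | p.1 < ENNReal.ofReal p.2}.indicator 1 (τ, h i ω) ∂P =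
      expNeg τ := by
    intro τ
    have hS' : MeasurableSet {x : ℝ | τ < ENNReal.ofReal x} :=
      measurableSet_lt measurable_const ENNReal.measurable_ofReal
    rw [← expMeasure_lt_ofReal, ← (hlaw i).map_eq, ← lintegral_indicator_one hS',
      lintegral_map (measurable_one.indicator hS') (hm i)]
    rfl
  rw [e1, key]
  simp only [e2]
  -- Setting the `i`-th coefficient to zero removes the serving station from the Laplace transform.
  have hc' : ∀ j, 0 ≤ if j = i then 0 else c j := fun j => by
    split_ifs
    · exact le_rfl
    · exact hc j
  have h3 := lintegral_expNeg_tsum hm hlaw hind hc'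
  simp only [hTdef, expNeg_add]
  have hT0 := measurable_threshold (fun j (_ : j ≠ i) => hm j) 0 c
  simp only [zero_add] at hT0
  have hT1 : Measurable fun ω =>
      expNeg (∑' j, if j = i then 0 else ENNReal.ofReal (c j * h j ω)) := measurable_expNeg.comp hT0
  rw [lintegral_const_mul _ hT1]
  have e3 : ∀ ω j, ENNReal.ofReal ((if j = i then 0 else c j) * h j ω) =
      if j = i then 0 else ENNReal.ofReal (c j * h j ω) := fun ω j => by split_ifs <;> simp
  have e4 : ∀ j, ENNReal.ofReal (Real.log (1 + if j = i then 0 else c j)) =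
      if j = i then 0 else ENNReal.ofReal (Real.log (1 + c j)) := fun j => by split_ifs <;> simp
  simp only [e3, e4] at h3
  rw [h3]

lemma lintegral_tsum_fading_ne_top (hm : ∀ j, Measurable (h j))
    (hlaw : ∀ j, HasLaw (h j) (expMeasure 1) P) {c : ℕ → ℝ} (hc : ∀ j, 0 ≤ c j)
    (hsum : ∑' j, ENNReal.ofReal (c j) ≠ ⊤) :
    ∫⁻ ω, ∑' j, ENNReal.ofReal (c j * h j ω) ∂P ≠ ⊤ := by
  rw [lintegral_tsum fun j => ((hm j).const_mul (c j)).ennreal_ofReal.aemeasurable]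
  have h1 : ∀ j, ∫⁻ ω, ENNReal.ofReal (c j * h j ω) ∂P =
      ENNReal.ofReal (c j) * ∫⁻ x, ENNReal.ofReal x ∂(expMeasure 1) := by
    intro j
    simp only [ENNReal.ofReal_mul (hc j)]
    rw [lintegral_const_mul _ (hm j).ennreal_ofReal, ← (hlaw j).map_eq,
      lintegral_map ENNReal.measurable_ofReal (hm j)]
  simp only [h1, ENNReal.tsum_mul_right]
  exact ENNReal.mul_ne_top hsum lintegral_ofReal_expMeasure_ne_top

end

/-! ### Path gain, coverage and measurability -/

section

/-- Path gain between `y` and `u`. -/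
noncomputable def gain (β : ℝ) (u y : Plane) : ℝ := (‖y - u‖ ^ β)⁻¹

lemma gain_nonneg (β : ℝ) (u y : Plane) : 0 ≤ gain β u y := by unfold gain; positivity

@[fun_prop] lemma measurable_gain (β : ℝ) (u : Plane) : Measurable (gain β u) := by
  unfold gain
  fun_prop

lemma lintegral_min_gain_ne_top {β : ℝ} (hβ : 2 < β) (u : Plane) :
    ∫⁻ y, min 1 (ENNReal.ofReal (gain β u y)) ≠ ⊤ := by
  -- With t = ‖y - u‖, the quantity (1 + t)/2 is at most 1 for t ≤ 1 and at most t for t ≥ 1; hence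
  -- the constant 2^β. Integrability of (1 + t)^(-β) in the plane is where β > 2 enters.
  have hle : ∀ y : Plane, min 1 (ENNReal.ofReal (gain β u y)) ≤
      ENNReal.ofReal (2 ^ β * (1 + ‖y - u‖) ^ (-β)) := by
    intro y
    have hb : 0 < β := by linarith
    have hn : 0 ≤ ‖y - u‖ := norm_nonneg _
    have e : 2 ^ β * (1 + ‖y - u‖) ^ (-β) = (((1 + ‖y - u‖) / 2) ^ β)⁻¹ := by
      rw [Real.div_rpow (by positivity) (by positivity), Real.rpow_neg (by positivity)]
      field_simp
    rw [e]
    rcases le_total ‖y - u‖ 1 with h | h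
    · refine (min_le_left _ _).trans ?_
      rw [← ENNReal.ofReal_one]
      refine ENNReal.ofReal_le_ofReal (one_le_inv_iff₀.2 ⟨by positivity, ?_⟩)
      exact Real.rpow_le_one (by positivity) (by linarith) hb.le
    · refine (min_le_right _ _).trans (ENNReal.ofReal_le_ofReal ?_)
      unfold gain
      gcongr
      linarith
  have hi : Integrable fun y : Plane => 2 ^ β * (1 + ‖y - u‖) ^ (-β) :=
    ((integrable_one_add_norm (E := Plane) (μ := volume) (r := β)
      (by simpa using hβ)).comp_sub_right u).const_mul _
  exact ne_top_of_le_ne_top hi.lintegral_lt_top.ne (lintegral_mono hle)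

/-- Minus the logarithm of the Laplace transform of the fading from `y`, for a user at `u` served
from `c` with threshold `z`. -/
noncomputable def logLaplace (β : ℝ) (u : Plane) (z : ℝ) (c y : Plane) : ℝ≥0∞ :=
  ENNReal.ofReal (Real.log (1 + z * ‖c - u‖ ^ β * gain β u y))

/-- Probability that the noise alone does not prevent coverage at threshold `z`, for a user at `u`
served from `x`. -/
noncomputable def noiseFactor (σ β : ℝ) (u : Plane) (z : ℝ) (x : Plane) : ℝ≥0∞ :=
  expNeg (ENNReal.ofReal (σ ^ 2 * ‖x - u‖ ^ β * z))

lemma continuous_noiseFactor (σ : ℝ) {β : ℝ} (hβ : 0 ≤ β) (u : Plane) (z : ℝ) :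
    Continuous (noiseFactor σ β u z) := by
  refine continuous_expNeg.comp (ENNReal.continuous_ofReal.comp ?_)
  exact (continuous_const.mul ((continuous_id.sub continuous_const).norm.rpow_const
    fun x => Or.inr hβ)).mul continuous_const

lemma measurable_logLaplace (β : ℝ) (u : Plane) (z : ℝ) (c : Plane) :
    Measurable (logLaplace β u z c) := by
  unfold logLaplace
  fun_prop

lemma continuous_logLaplace {β : ℝ} (hβ : 0 ≤ β) (u : Plane) {z : ℝ} (hz : 0 ≤ z) (y : Plane) :
    Continuous fun c => logLaplace β u z c y := by
  refine ENNReal.continuous_ofReal.comp (Continuous.log ?_ fun c => ?_)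
  · exact continuous_const.add ((continuous_const.mul
      ((continuous_id.sub continuous_const).norm.rpow_const fun x => Or.inr hβ)).mul
        continuous_const)
  · have := gain_nonneg β u y
    positivity

/-- log(1 + t) ≤ t, and the coefficient z ‖c - u‖^β is continuous in c, so near x it is below its
value at x plus 1. -/
lemma logLaplace_le {β : ℝ} (hβ : 0 ≤ β) (u : Plane) {z : ℝ} (hz : 0 ≤ z) (x : Plane) :
    ∃ A : ℝ≥0, ∀ᶠ c in 𝓝 x, ∀ y, logLaplace β u z c y ≤ A * ENNReal.ofReal (gain β u y) := by
  have hc : Continuous fun c : Plane => z * ‖c - u‖ ^ β :=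
    continuous_const.mul ((continuous_id.sub continuous_const).norm.rpow_const
      fun x => Or.inr hβ)
  refine ⟨(z * ‖x - u‖ ^ β + 1).toNNReal, ?_⟩
  filter_upwards [(hc.tendsto x).eventually (gt_mem_nhds (lt_add_one _))] with c h y
  have hg := gain_nonneg β u y
  rw [← ENNReal.ofReal, ← ENNReal.ofReal_mul (by positivity)]
  refine ENNReal.ofReal_le_ofReal ?_
  have h0 : 0 ≤ z * ‖c - u‖ ^ β * gain β u y := by positivity
  have := Real.log_le_sub_one_of_pos (x := 1 + z * ‖c - u‖ ^ β * gain β u y) (by linarith)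
  calc _ ≤ z * ‖c - u‖ ^ β * gain β u y := by linarith
    _ ≤ _ := by gcongr

variable {Ω : Type*} [MeasurableSpace Ω] {P : Measure Ω} {lam : ℝ} {X : ℕ → Ω → Plane}

open Classical in
lemma lintegral_coverage [IsProbabilityMeasure P] (hlam : 0 < lam) (hX : IsHomogeneousPPP P lam X)
    (σ : ℝ) {β : ℝ} (hβ : 2 < β) (u : Plane) {z : ℝ} (hz : 0 ≤ z) :
    ∫⁻ ω, noiseFactor σ β u z (X (nearestIndex fun i => X i ω) ω) *
        expNeg (∑' j, if j = nearestIndex fun i => X i ω then 0 else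
          logLaplace β u z (X (nearestIndex fun i => X i ω) ω) (X j ω)) ∂P =
      ENNReal.ofReal lam * ∫⁻ x, noiseFactor σ β u z x *
        voidLaplace lam ‖x‖ (logLaplace β u z x) := by
  have hβ0 : 0 ≤ β := by linarith
  exact lintegral_nearest hlam hX (continuous_noiseFactor σ hβ0 u z) (fun x => expNeg_le_one _)
    (measurable_logLaplace β u z) (continuous_logLaplace hβ0 u hz)
    (measurable_gain β u).ennreal_ofReal (fun y => ENNReal.ofReal_ne_top)
    (lintegral_min_gain_ne_top hβ u) (logLaplace_le hβ0 u hz)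

/-- The layer-cake formula, log(1 + S) being the integral of 1/(1 + z) over (0, S). -/
lemma ofReal_log_one_add {S : ℝ} (hS : 0 ≤ S) :
    ENNReal.ofReal (Real.log (1 + S)) =
      ∫⁻ z in Ioi 0, ENNReal.ofReal (1 + z)⁻¹ * {z | z < S}.indicator 1 z := by
  have h1 : ∀ z : ℝ, ENNReal.ofReal (1 + z)⁻¹ * {z | z < S}.indicator 1 z =
      (Iio S).indicator (fun z => ENNReal.ofReal (1 + z)⁻¹) z := by
    intro z
    by_cases h : z < S <;> simp [h]
  simp only [h1]
  rw [lintegral_indicator measurableSet_Iio, Measure.restrict_restrict measurableSet_Iio,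
    inter_comm, Ioi_inter_Iio, setLIntegral_congr Ioo_ae_eq_Ioc]
  have hpos : ∀ x ∈ uIcc 0 S, (0 : ℝ) < 1 + x := fun x hx => by
    rw [uIcc_of_le hS] at hx
    linarith [hx.1]
  have hint : IntervalIntegrable (fun z : ℝ => (1 + z)⁻¹) volume 0 S :=
    ContinuousOn.intervalIntegrable (ContinuousOn.inv₀ (by fun_prop) fun x hx => (hpos x hx).ne')
  rw [← ofReal_integral_eq_lintegral_ofReal, ← intervalIntegral.integral_of_le hS,
    intervalIntegral.integral_eq_sub_of_hasDerivAt (f := fun z => Real.log (1 + z)) _ hint]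
  · simp
  · intro x hx
    have := ((hasDerivAt_id x).const_add 1).log (hpos x hx).ne'
    simpa using this
  · exact (intervalIntegrable_iff_integrableOn_Ioc_of_le hS).1 hint
  · refine (ae_restrict_iff' measurableSet_Ioc).2 (ae_of_all _ fun z hz => ?_)
    have := hz.1
    simp only [Pi.zero_apply]
    positivity

lemma measurable_nearestIndex : Measurable nearestIndex := by
  have hS : ∀ i, MeasurableSet {x : ℕ → Plane | ∀ j, ‖x i‖ ≤ ‖x j‖} := fun i => by
    rw [ofPred_forall]
    exact MeasurableSet.iInter fun j => measurableSet_le (by fun_prop) (by fun_prop)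
  refine measurable_of_Iic fun n => ?_
  -- Without a minimiser, `sInf ∅ = 0` puts the configuration in every sublevel set, hence the
  -- second term.
  have : nearestIndex ⁻¹' Iic n = (⋃ i ∈ Iic n, {x : ℕ → Plane | ∀ j, ‖x i‖ ≤ ‖x j‖}) ∪
      ⋂ i, {x : ℕ → Plane | ∀ j, ‖x i‖ ≤ ‖x j‖}ᶜ := by
    ext x
    simp only [mem_preimage, mem_Iic, mem_union, mem_iUnion, mem_iInter, mem_compl_iff,
      exists_prop]
    constructor
    · intro hx
      by_cases hne : {i : ℕ | ∀ j, ‖x i‖ ≤ ‖x j‖}.Nonempty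
      · exact Or.inl ⟨_, hx, Nat.sInf_mem hne⟩
      · exact Or.inr fun i hi => hne ⟨i, hi⟩
    · rintro (⟨i, hi, hxi⟩ | h)
      · exact (Nat.sInf_le hxi).trans hi
      · have : {i : ℕ | ∀ j, ‖x i‖ ≤ ‖x j‖} = ∅ := eq_empty_iff_forall_notMem.2 h
        rw [nearestIndex, this, Nat.sInf_empty]
        exact zero_le
  rw [this]
  exact (MeasurableSet.biUnion (to_countable _) fun i _ => hS i).union
    (MeasurableSet.iInter fun i => (hS i).compl)

lemma measurable_eval_nearestIndex {E : Type*} [MeasurableSpace E] :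
    Measurable fun p : (ℕ → Plane) × (ℕ → E) => p.2 (nearestIndex p.1) := by
  have h : Measurable fun p : (ℕ → E) × ℕ => p.1 p.2 :=
    measurable_from_prod_countable_left fun n => measurable_pi_apply n
  exact h.comp (measurable_snd.prodMk (measurable_nearestIndex.comp measurable_fst))

open Classical in
/-- The fading of the serving base station exceeds this value exactly when the signal to
interference plus noise ratio exceeds `z`. -/
noncomputable def fadingThreshold (σ β : ℝ) (u : Plane) (x : ℕ → Plane) (h : ℕ → ℝ) (z : ℝ) :
    ℝ≥0∞ :=
  ENNReal.ofReal (σ ^ 2 * ‖x (nearestIndex x) - u‖ ^ β * z) +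
    ∑' j, if j = nearestIndex x then 0 else
      ENNReal.ofReal (z * ‖x (nearestIndex x) - u‖ ^ β * gain β u (x j) * h j)

lemma measurable_fadingThreshold (σ β : ℝ) (u : Plane) :
    Measurable fun p : ((ℕ → Plane) × (ℕ → ℝ)) × ℝ => fadingThreshold σ β u p.1.1 p.1.2 p.2 := by
  have hb : Measurable fun p : ((ℕ → Plane) × (ℕ → ℝ)) × ℝ => p.1.1 (nearestIndex p.1.1) :=
    measurable_eval_nearestIndex.comp
      ((measurable_fst.comp measurable_fst).prodMk (measurable_fst.comp measurable_fst))
  have hn : Measurable fun p : ((ℕ → Plane) × (ℕ → ℝ)) × ℝ => nearestIndex p.1.1 :=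
    measurable_nearestIndex.comp (measurable_fst.comp measurable_fst)
  have hw : Measurable fun p : ((ℕ → Plane) × (ℕ → ℝ)) × ℝ =>
      ‖p.1.1 (nearestIndex p.1.1) - u‖ ^ β := (hb.sub_const u).norm.pow_const β
  refine Measurable.add ((hw.const_mul _).mul measurable_snd).ennreal_ofReal
    (Measurable.tsum fun j => Measurable.ite (measurableSet_eq_fun measurable_const hn)
      measurable_const ?_)
  have hg : Measurable fun p : ((ℕ → Plane) × (ℕ → ℝ)) × ℝ => gain β u (p.1.1 j) :=
    (measurable_gain β u).comp (by fun_prop)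
  have hh : Measurable fun p : ((ℕ → Plane) × (ℕ → ℝ)) × ℝ => p.1.2 j := by fun_prop
  exact (((measurable_snd.mul hw).mul hg).mul hh).ennreal_ofReal

end

/-! ### The mean rate as an integral of coverage probabilities -/

section

section Deterministic

variable {σ β : ℝ} {u : Plane} {x : ℕ → Plane} {h : ℕ → ℝ}

lemma summable_gain_mul (hh : ∀ j, 0 ≤ h j)
    (hs : ∑' j, ENNReal.ofReal (gain β u (x j) * h j) ≠ ⊤) :
    Summable fun j => h j / ‖x j - u‖ ^ β := by
  refine (ENNReal.summable_toReal hs).congr fun j => ?_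
  rw [ENNReal.toReal_ofReal (mul_nonneg (gain_nonneg _ _ _) (hh j)), gain, mul_comm, div_eq_mul_inv]

lemma interference_nonneg (hh : ∀ j, 0 ≤ h j) (i : ℕ) : 0 ≤ interference β x h u i :=
  tsum_nonneg fun j => div_nonneg (hh _) (by positivity)

lemma sinr_nonneg (hh : ∀ j, 0 ≤ h j) (i : ℕ) : 0 ≤ sinr σ β x h u i := by
  have := interference_nonneg (β := β) (u := u) (x := x) hh i
  have := hh i
  unfold sinr
  positivity

open Classical in
lemma tsum_ite_eq_ofReal_interference (hh : ∀ j, 0 ≤ h j)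
    (hs : ∑' j, ENNReal.ofReal (gain β u (x j) * h j) ≠ ⊤) (i : ℕ) :
    ∑' j, (if j = i then 0 else ENNReal.ofReal (gain β u (x j) * h j)) =
      ENNReal.ofReal (interference β x h u i) := by
  have h0 : ∀ j, 0 ≤ h j / ‖x j - u‖ ^ β := fun j => div_nonneg (hh j) (by positivity)
  have e : interference β x h u i = ∑' j, {j | j ≠ i}.indicator (fun j => h j / ‖x j - u‖ ^ β) j :=
    tsum_subtype {j | j ≠ i} fun j => h j / ‖x j - u‖ ^ β
  rw [e, ENNReal.ofReal_tsum_of_nonneg (fun j => indicator_nonneg (fun j _ => h0 j) j)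
      ((summable_gain_mul hh hs).indicator _)]
  refine tsum_congr fun j => ?_
  by_cases hj : j = i
  · simp [hj]
  · rw [if_neg hj, indicator_of_mem (by exact hj), gain, mul_comm, div_eq_mul_inv]

lemma fadingThreshold_eq (hh : ∀ j, 0 ≤ h j)
    (hs : ∑' j, ENNReal.ofReal (gain β u (x j) * h j) ≠ ⊤) {z : ℝ} (hz : 0 ≤ z) :
    fadingThreshold σ β u x h z = ENNReal.ofReal (z * ‖x (nearestIndex x) - u‖ ^ β *
      (σ ^ 2 + interference β x h u (nearestIndex x))) := by
  have hI := interference_nonneg (β := β) (u := u) (x := x) hh (nearestIndex x)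
  rw [mul_add, ENNReal.ofReal_add (by positivity) (by positivity),
    ENNReal.ofReal_mul (p := z * ‖x (nearestIndex x) - u‖ ^ β)
      (q := interference β x h u (nearestIndex x)) (by positivity),
    ← tsum_ite_eq_ofReal_interference hh hs, ← ENNReal.tsum_mul_left, fadingThreshold]
  congr 1
  · congr 1
    ring
  · refine tsum_congr fun j => ?_
    split_ifs
    · simp
    · rw [mul_assoc, ENNReal.ofReal_mul (by positivity)]

/-- Clear denominators in SINR > z. The serving station must differ from `u` for its path loss to be
positive. -/
lemma ofReal_rate_eq (hσ : 0 < σ ^ 2) (hh : ∀ j, 0 ≤ h j)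
    (hs : ∑' j, ENNReal.ofReal (gain β u (x j) * h j) ≠ ⊤) (hu : x (nearestIndex x) ≠ u) :
    ENNReal.ofReal (Real.log (1 + sinr σ β x h u (nearestIndex x))) =
      ∫⁻ z in Ioi 0, ENNReal.ofReal (1 + z)⁻¹ *
        {z | fadingThreshold σ β u x h z < ENNReal.ofReal (h (nearestIndex x))}.indicator 1 z := by
  rw [ofReal_log_one_add (sinr_nonneg hh _)]
  refine setLIntegral_congr_fun measurableSet_Ioi fun z hz => ?_
  have hz : 0 < z := hz
  have hI := interference_nonneg (β := β) (u := u) (x := x) hh (nearestIndex x)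
  have hw : 0 < ‖x (nearestIndex x) - u‖ := norm_pos_iff.2 (sub_ne_zero.2 hu)
  have hwb : 0 < ‖x (nearestIndex x) - u‖ ^ β := Real.rpow_pos_of_pos hw _
  have key : z < sinr σ β x h u (nearestIndex x) ↔
      fadingThreshold σ β u x h z < ENNReal.ofReal (h (nearestIndex x)) := by
    rw [fadingThreshold_eq hh hs hz.le, sinr, lt_div_iff₀ (by positivity), Real.rpow_neg hw.le,
      ← div_eq_mul_inv, lt_div_iff₀ hwb, ENNReal.ofReal_lt_ofReal_iff']
    constructor
    · intro hlt
      have e : z * ‖x (nearestIndex x) - u‖ ^ β * (σ ^ 2 + interference β x h u (nearestIndex x)) =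
        z * (σ ^ 2 + interference β x h u (nearestIndex x)) * ‖x (nearestIndex x) - u‖ ^ β := by
          ring
      rw [e]
      exact ⟨hlt, lt_of_le_of_lt (by positivity) hlt⟩
    · rintro ⟨hlt, -⟩
      linarith
  by_cases hk : z < sinr σ β x h u (nearestIndex x)
  · rw [indicator_of_mem (by exact hk), indicator_of_mem (by exact key.1 hk)]
  · rw [indicator_of_notMem (by exact hk),
      indicator_of_notMem (by exact fun hk' => hk (key.2 hk'))]

end Deterministic

variable {Ω : Type*} [MeasurableSpace Ω] {P : Measure Ω} {lam : ℝ} {X : ℕ → Ω → Plane}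
  {h : ℕ → Ω → ℝ}

/-- The intensity measure, a multiple of Lebesgue measure, has no atoms. -/
lemma ae_points_ne (hlam : 0 < lam) (hX : IsHomogeneousPPP P lam X) (u : Plane) :
    ∀ᵐ ω ∂P, ∀ j, X j ω ≠ u := by
  rw [ae_all_iff]
  intro j
  have h1 : Measure.sum (fun j => P.map (X j)) {u} = 0 := by
    rw [sum_map_eq hlam hX]
    simp
  have h2 := Measure.le_sum_apply (fun j => P.map (X j)) {u}
  rw [Measure.sum_apply _ (measurableSet_singleton u), ENNReal.tsum_eq_zero] at h1
  have h3 := h1 j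
  rw [Measure.map_apply (hX.measurable j) (measurableSet_singleton u)] at h3
  exact measure_eq_zero_iff_ae_notMem.1 h3

/-- The argument is conditional on the points, because the path gain is not integrable near `u`: its
sum over the points is almost surely finite, and then the fadings add only a finite mean factor. -/
lemma ae_tsum_gain_mul_ne_top [IsProbabilityMeasure P] (hlam : 0 < lam)
    (hX : IsHomogeneousPPP P lam X) (hm : ∀ j, Measurable (h j))
    (hlaw : ∀ j, HasLaw (h j) (expMeasure 1) P)
    (hXh : IndepFun (fun ω i => X i ω) (fun ω j => h j ω) P) {β : ℝ} (hβ : 2 < β) (u : Plane) :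
    ∀ᵐ ω ∂P, ∑' j, ENNReal.ofReal (gain β u (X j ω) * h j ω) ≠ ⊤ := by
  have hXm : Measurable fun ω i => X i ω := measurable_pi_lambda _ hX.measurable
  have hhm : Measurable fun ω j => h j ω := measurable_pi_lambda _ hm
  have hF : Measurable fun p : (ℕ → Plane) × (ℕ → ℝ) =>
      ∑' j, ENNReal.ofReal (gain β u (p.1 j) * p.2 j) := by
    refine Measurable.tsum fun j => ?_
    have hg : Measurable fun p : (ℕ → Plane) × (ℕ → ℝ) => gain β u (p.1 j) :=
      (measurable_gain β u).comp (by fun_prop)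
    exact (hg.mul (by fun_prop)).ennreal_ofReal
  have hS : MeasurableSet {p : (ℕ → Plane) × (ℕ → ℝ) |
      ∑' j, ENNReal.ofReal (gain β u (p.1 j) * p.2 j) = ⊤} := hF (measurableSet_singleton ⊤)
  have hind : Measurable ({p : (ℕ → Plane) × (ℕ → ℝ) |
      ∑' j, ENNReal.ofReal (gain β u (p.1 j) * p.2 j) = ⊤}.indicator
        (1 : (ℕ → Plane) × (ℕ → ℝ) → ℝ≥0∞)) := measurable_one.indicator hS
  have hindω : Measurable fun ω => {p : (ℕ → Plane) × (ℕ → ℝ) |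
      ∑' j, ENNReal.ofReal (gain β u (p.1 j) * p.2 j) = ⊤}.indicator
        (1 : (ℕ → Plane) × (ℕ → ℝ) → ℝ≥0∞) ((fun i => X i ω), fun j => h j ω) :=
    hind.comp (hXm.prodMk hhm)
  have key := lintegral_of_indepFun hXm hhm hXh hind
  have hae : ∀ᵐ ω' ∂P, ∫⁻ ω, {p : (ℕ → Plane) × (ℕ → ℝ) |
      ∑' j, ENNReal.ofReal (gain β u (p.1 j) * p.2 j) = ⊤}.indicator 1
        ((fun i => X i ω'), fun j => h j ω) ∂P = (0 : ℝ≥0∞) := by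
    filter_upwards [ae_tsum_ne_top hlam hX (measurable_gain β u).ennreal_ofReal
      (fun y => ENNReal.ofReal_ne_top) (lintegral_min_gain_ne_top hβ u)] with ω' hω'
    have h1 := lintegral_tsum_fading_ne_top hm hlaw (fun j => gain_nonneg β u (X j ω')) hω'
    have h2 := ae_lt_top (hF.comp (measurable_const.prodMk hhm)) h1
    rw [lintegral_congr_ae (g := 0)]
    · simp
    · filter_upwards [h2] with ω hω
      exact indicator_of_notMem (by exact fun hmem => hω.ne hmem) _
  rw [lintegral_congr_ae hae, lintegral_zero, lintegral_eq_zero_iff hindω] at key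
  filter_upwards [key] with ω hω htop
  have h1 : {p : (ℕ → Plane) × (ℕ → ℝ) |
      ∑' j, ENNReal.ofReal (gain β u (p.1 j) * p.2 j) = ⊤}.indicator (1 : (ℕ → Plane) × (ℕ → ℝ) → ℝ≥0∞)
        ((fun i => X i ω), fun j => h j ω) = 1 := indicator_of_mem (by exact htop) _
  rw [h1] at hω
  exact one_ne_zero hω

-- Layer cake, exchange of the integrals over z and ω, conditional coverage with frozen points, then
-- the law of the nearest point.
open Classical in
theorem lintegral_rate [IsProbabilityMeasure P] (hlam : 0 < lam)
    (hX : IsHomogeneousPPP P lam X) (hm : ∀ j, Measurable (h j))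
    (hlaw : ∀ j, HasLaw (h j) (expMeasure 1) P) (hind : iIndepFun h P)
    (hXh : IndepFun (fun ω i => X i ω) (fun ω j => h j ω) P) {σ β : ℝ} (hσ : 0 < σ ^ 2)
    (hβ : 2 < β) (u : Plane) :
    ∫⁻ ω, ENNReal.ofReal (Real.log (1 + sinr σ β (fun i => X i ω) (fun j => h j ω) u
        (nearestIndex fun i => X i ω))) ∂P =
      ∫⁻ z in Ioi 0, ENNReal.ofReal (1 + z)⁻¹ * (ENNReal.ofReal lam *
        ∫⁻ x, noiseFactor σ β u z x * voidLaplace lam ‖x‖ (logLaplace β u z x)) := by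
  have hXm : Measurable fun ω i => X i ω := measurable_pi_lambda _ hX.measurable
  have hhm : Measurable fun ω j => h j ω := measurable_pi_lambda _ hm
  have hS : MeasurableSet {p : ((ℕ → Plane) × (ℕ → ℝ)) × ℝ |
      fadingThreshold σ β u p.1.1 p.1.2 p.2 < ENNReal.ofReal (p.1.2 (nearestIndex p.1.1))} :=
    measurableSet_lt (measurable_fadingThreshold σ β u)
      (measurable_eval_nearestIndex.comp measurable_fst).ennreal_ofReal
  set S := {p : ((ℕ → Plane) × (ℕ → ℝ)) × ℝ |
      fadingThreshold σ β u p.1.1 p.1.2 p.2 < ENNReal.ofReal (p.1.2 (nearestIndex p.1.1))} with hSdef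
  have hSm : Measurable (S.indicator (1 : ((ℕ → Plane) × (ℕ → ℝ)) × ℝ → ℝ≥0∞)) := measurable_one.indicator hS
  have h1 : ∫⁻ ω, ENNReal.ofReal (Real.log (1 + sinr σ β (fun i => X i ω) (fun j => h j ω) u
        (nearestIndex fun i => X i ω))) ∂P =
      ∫⁻ ω, (∫⁻ z in Ioi 0, ENNReal.ofReal (1 + z)⁻¹ *
        S.indicator 1 (((fun i => X i ω), fun j => h j ω), z)) ∂P := by
    refine lintegral_congr_ae ?_
    filter_upwards [ae_nonneg_of_hasLaw hlaw, ae_tsum_gain_mul_ne_top hlam hX hm hlaw hXh hβ u,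
      ae_points_ne hlam hX u] with ω hω1 hω2 hω3
    rw [ofReal_rate_eq hσ hω1 hω2 (hω3 _)]
    rfl
  have hmeas : Measurable fun q : Ω × ℝ => ENNReal.ofReal (1 + q.2)⁻¹ *
      S.indicator 1 (((fun i => X i q.1), fun j => h j q.1), q.2) :=
    Measurable.mul (by fun_prop)
      (hSm.comp (((hXm.comp measurable_fst).prodMk (hhm.comp measurable_fst)).prodMk
        measurable_snd))
  rw [h1, lintegral_lintegral_swap hmeas.aemeasurable]
  refine setLIntegral_congr_fun measurableSet_Ioi fun z hz => ?_
  have hz : 0 < z := hz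
  let Φ : (ℕ → Plane) × (ℕ → ℝ) → ℝ≥0∞ := fun p =>
    S.indicator (1 : ((ℕ → Plane) × (ℕ → ℝ)) × ℝ → ℝ≥0∞) (p, z)
  have hΦ : Measurable Φ := hSm.comp (measurable_id.prodMk measurable_const)
  have hΦω : Measurable fun ω => Φ ((fun i => X i ω), fun j => h j ω) :=
    hΦ.comp (hXm.prodMk hhm)
  refine (lintegral_const_mul _ hΦω).trans ?_
  rw [lintegral_of_indepFun hXm hhm hXh hΦ, ← lintegral_coverage hlam hX σ hβ u hz.le]
  congr 1
  -- With the points frozen at ω', the serving index is a constant, so the coverage formula for a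
  -- fixed index applies.
  refine lintegral_congr fun ω' => ?_
  have hcov := measure_lt_fading hm hlaw hind (nearestIndex fun i => X i ω')
    (ENNReal.ofReal (σ ^ 2 * ‖X (nearestIndex fun i => X i ω') ω' - u‖ ^ β * z))
    (c := fun j => z * ‖X (nearestIndex fun i => X i ω') ω' - u‖ ^ β * gain β u (X j ω'))
    (fun j => mul_nonneg (by positivity) (gain_nonneg _ _ _))
  refine Eq.trans ?_ hcov
  have hSω : MeasurableSet {ω | ((((fun i => X i ω'), fun j => h j ω) :
      (ℕ → Plane) × (ℕ → ℝ)), z) ∈ S} :=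
    ((measurable_const.prodMk hhm).prodMk measurable_const) hS
  refine Eq.trans ?_ ((lintegral_indicator_one (μ := P) hSω).trans ?_)
  · rfl
  · rw [hSdef]
    congr 1

end

/-! ### Polar coordinates and elementary bounds -/

/-- The point with polar coordinates `(r, θ)`. -/
noncomputable def polarPoint (r θ : ℝ) : Plane := !₂[r * Real.cos θ, r * Real.sin θ]

@[fun_prop] lemma measurable_polarPoint : Measurable fun p : ℝ × ℝ => polarPoint p.2 p.1 := by
  unfold polarPoint
  refine (PiLp.volume_preserving_toLp (Fin 2)).measurable.comp (measurable_pi_lambda _ fun i => ?_)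
  fin_cases i
  · exact measurable_snd.mul (Real.measurable_cos.comp measurable_fst)
  · exact measurable_snd.mul (Real.measurable_sin.comp measurable_fst)

lemma norm_polarPoint_sub (u r θ : ℝ) : ‖polarPoint r θ - !₂[u, 0]‖ = w u r θ := by
  rw [EuclideanSpace.norm_eq, w, Fin.sum_univ_two]
  congr 1
  simp only [polarPoint, PiLp.sub_apply, Matrix.cons_val_zero, Matrix.cons_val_one,
    Real.norm_eq_abs, sq_abs, sub_zero]
  linear_combination r ^ 2 * Real.sin_sq_add_cos_sq θ

lemma norm_polarPoint {r : ℝ} (hr : 0 ≤ r) (θ : ℝ) : ‖polarPoint r θ‖ = r := by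
  have h := norm_polarPoint_sub 0 r θ
  have h0 : (!₂[(0 : ℝ), 0] : Plane) = 0 := by ext i; fin_cases i <;> rfl
  rw [h0, sub_zero] at h
  rw [h, w]
  simp [Real.sqrt_sq hr]

lemma polarPoint_add_two_pi (r θ : ℝ) : polarPoint r (θ + 2 * Real.pi) = polarPoint r θ := by
  simp [polarPoint]

/-- Moves the angle from (-π, π], the range of `polarCoord` up to an endpoint, to (0, 2π]. -/
lemma setLIntegral_Ioc_eq_of_periodic {T : ℝ} (hT : 0 < T) {g : ℝ → ℝ≥0∞}
    (hg : Function.Periodic g T) (t s : ℝ) :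
    ∫⁻ x in Ioc t (t + T), g x = ∫⁻ x in Ioc s (s + T), g x := by
  have : VAddInvariantMeasure (AddSubgroup.zmultiples T) ℝ volume :=
    ⟨fun c s _ => measure_preimage_add _ _ _⟩
  exact (isAddFundamentalDomain_Ioc hT t).setLIntegral_eq (isAddFundamentalDomain_Ioc hT s) g
    hg.map_vadd_zmultiples

lemma lintegral_plane_polar {F : Plane → ℝ≥0∞} (hF : Measurable F) :
    ∫⁻ x, F x = ∫⁻ θ in Ioc 0 (2 * Real.pi), ∫⁻ r in Ioi 0,
      ENNReal.ofReal r * F (polarPoint r θ) := by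
  let e : ℝ × ℝ ≃ᵐ Plane :=
    (MeasurableEquiv.finTwoArrow (α := ℝ)).symm.trans (MeasurableEquiv.toLp 2 (Fin 2 → ℝ))
  have he : MeasurePreserving e volume volume :=
    (PiLp.volume_preserving_toLp (Fin 2)).comp (volume_preserving_finTwoArrow ℝ).symm
  have hm : Measurable fun p : ℝ × ℝ => ENNReal.ofReal p.2 * F (polarPoint p.2 p.1) :=
    (measurable_snd.ennreal_ofReal).mul (hF.comp measurable_polarPoint)
  have hm' : Measurable fun p : ℝ × ℝ => ENNReal.ofReal p.1 * F (polarPoint p.1 p.2) :=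
    hm.comp measurable_swap
  rw [← he.lintegral_comp hF, ← lintegral_comp_polarCoord_symm]
  have h1 : ∀ p : ℝ × ℝ, ENNReal.ofReal p.1 • F (e (polarCoord.symm p)) =
      ENNReal.ofReal p.1 * F (polarPoint p.1 p.2) := by
    intro p
    rw [smul_eq_mul]
    congr 2
  simp only [h1]
  rw [show polarCoord.target = Ioi (0 : ℝ) ×ˢ Ioo (-Real.pi) Real.pi from rfl, Measure.volume_eq_prod,
    setLIntegral_prod_symm _ hm'.aemeasurable, setLIntegral_congr Ioo_ae_eq_Ioc]
  have hper : Function.Periodic (fun θ => ∫⁻ r in Ioi 0, ENNReal.ofReal r * F (polarPoint r θ))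
      (2 * Real.pi) := fun θ => by simp only [polarPoint_add_two_pi]
  have := setLIntegral_Ioc_eq_of_periodic Real.two_pi_pos hper (-Real.pi) 0
  rw [zero_add, show -Real.pi + 2 * Real.pi = Real.pi by ring] at this
  exact this

/-- In polar coordinates the Jacobian r cancels 1/r. -/
lemma lintegral_inv_norm_ball_ne_top (c : Plane) :
    ∫⁻ x in Metric.ball c 1, ENNReal.ofReal ‖x - c‖⁻¹ ≠ ⊤ := by
  rw [← lintegral_indicator measurableSet_ball]
  have h1 : ∫⁻ x, (Metric.ball c 1).indicator (fun x => ENNReal.ofReal ‖x - c‖⁻¹) x =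
      ∫⁻ x : Plane, (Metric.ball 0 1).indicator (fun x => ENNReal.ofReal ‖x‖⁻¹) x := by
    rw [← lintegral_sub_right_eq_self
      (fun x : Plane => (Metric.ball 0 1).indicator (fun x => ENNReal.ofReal ‖x‖⁻¹) x) c]
    refine lintegral_congr fun x => ?_
    by_cases hx : ‖x - c‖ < 1
    · rw [indicator_of_mem (by simpa [dist_eq_norm] using hx),
        indicator_of_mem (by simpa using hx)]
    · rw [indicator_of_notMem (by simpa [dist_eq_norm] using hx),
        indicator_of_notMem (by simpa using hx)]
  rw [h1, lintegral_plane_polar (Measurable.indicator (by fun_prop) measurableSet_ball)]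
  have h2 : ∀ θ : ℝ, ∫⁻ r in Ioi 0, ENNReal.ofReal r *
      (Metric.ball (0 : Plane) 1).indicator (fun x => ENNReal.ofReal ‖x‖⁻¹) (polarPoint r θ) ≤ 1 := by
    intro θ
    calc _ ≤ ∫⁻ r in Ioi (0 : ℝ), (Iio (1 : ℝ)).indicator 1 r := by
          refine setLIntegral_mono' measurableSet_Ioi fun r hr => ?_
          have hr : 0 < r := hr
          by_cases h : r < 1
          · rw [indicator_of_mem (by simpa [norm_polarPoint hr.le] using h),
              indicator_of_mem (by exact h), norm_polarPoint hr.le, ← ENNReal.ofReal_mul hr.le,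
              mul_inv_cancel₀ hr.ne']
            simp
          · rw [indicator_of_notMem (by simpa [norm_polarPoint hr.le] using h)]
            simp
      _ = 1 := by
          rw [lintegral_indicator_one measurableSet_Iio, Measure.restrict_apply measurableSet_Iio,
            Iio_inter_Ioi]
          simp
  refine ne_top_of_le_ne_top ?_ (lintegral_mono h2)
  simp only [lintegral_const, one_mul, Measure.restrict_apply_univ, Real.volume_Ioc, ne_eq]
  exact ENNReal.ofReal_ne_top

lemma lintegral_Ioi_rpow_div_ne_top {a : ℝ} (ha0 : 0 < a) (ha1 : a < 1) :
    ∫⁻ z in Ioi (0 : ℝ), ENNReal.ofReal ((1 + z)⁻¹ * z ^ (-a)) ≠ ⊤ := by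
  have h1 : IntegrableOn (fun z : ℝ => z ^ (-a)) (Ioc 0 1) := by
    have := intervalIntegral.intervalIntegrable_rpow' (a := 0) (b := 1) (r := -a) (by linarith)
    exact (intervalIntegrable_iff_integrableOn_Ioc_of_le zero_le_one).1 this
  have h2 : IntegrableOn (fun z : ℝ => z ^ (-1 - a)) (Ioi 1) :=
    integrableOn_Ioi_rpow_of_lt (by linarith) one_pos
  rw [← Ioc_union_Ioi_eq_Ioi zero_le_one]
  refine ne_top_of_le_ne_top (ENNReal.add_ne_top.2 ⟨h1.lintegral_lt_top.ne, h2.lintegral_lt_top.ne⟩)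
    ((lintegral_union_le _ _ _).trans (add_le_add ?_ ?_))
  · refine setLIntegral_mono' measurableSet_Ioc fun z hz => ENNReal.ofReal_le_ofReal ?_
    have hz0 : 0 < z := hz.1
    have : (1 + z)⁻¹ ≤ 1 := inv_le_one_of_one_le₀ (by linarith)
    exact mul_le_of_le_one_left (by positivity) this
  · refine setLIntegral_mono' measurableSet_Ioi fun z hz => ENNReal.ofReal_le_ofReal ?_
    have hz1 : 1 < z := hz
    have hz0 : 0 < z := by linarith
    rw [sub_eq_add_neg, Real.rpow_add hz0, Real.rpow_neg_one]
    gcongr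
    linarith

lemma exp_neg_le_rpow {a y : ℝ} (ha0 : 0 < a) (ha1 : a < 1) (hy : 0 < y) :
    Real.exp (-y) ≤ y ^ (-a) := by
  rcases le_total y 1 with h | h
  · exact (Real.exp_le_one_iff.2 (by linarith)).trans
      (Real.one_le_rpow_of_pos_of_le_one_of_nonpos hy h (by linarith))
  · calc Real.exp (-y) ≤ y ^ (-1 : ℝ) := by
          rw [Real.exp_neg, Real.rpow_neg_one]
          gcongr
          linarith [Real.add_one_le_exp y]
      _ ≤ y ^ (-a) := Real.rpow_le_rpow_of_exponent_le h (by linarith)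

lemma measurableSet_lt_norm (r : ℝ) : MeasurableSet {y : Plane | r < ‖y‖} :=
  measurableSet_lt measurable_const measurable_norm

/-- The disk contributes the void probability exp(-λπr²), and the exterior contributes the factor
that becomes ρ₂. -/
lemma voidLaplace_eq (lam r : ℝ) (g : Plane → ℝ≥0∞) :
    voidLaplace lam r g = voidLaplace lam r 0 *
      expNeg (ENNReal.ofReal lam * ∫⁻ y in {y | r < ‖y‖}, (1 - expNeg (g y))) := by
  have h : ∀ y, 1 - expNeg (killDisk r g y) = (1 - expNeg (killDisk r 0 y)) +
      {y | r < ‖y‖}.indicator (fun y => 1 - expNeg (g y)) y := by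
    intro y
    by_cases hy : ‖y‖ ≤ r
    · rw [indicator_of_notMem (by simpa using hy)]
      simp [killDisk, hy]
    · rw [indicator_of_mem (by simpa using hy)]
      simp [killDisk, hy]
  have hm : Measurable fun y => 1 - expNeg (killDisk r 0 y) :=
    measurable_const.sub (measurable_expNeg.comp (measurable_killDisk r measurable_zero))
  rw [voidLaplace, voidLaplace, ← expNeg_add, ← mul_add]
  simp only [h]
  rw [lintegral_add_left hm, lintegral_indicator (measurableSet_lt_norm r)]

/-! ### The exterior factor ρ₂ -/

section Rho

variable {lam σ β u z r θ : ℝ}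

/-- 1 - 1/(1 + a) = 1/(1 + 1/a) with a = z (‖c - U‖/‖y - U‖)^β. -/
lemma one_sub_expNeg_logLaplace (hz : 0 < z) (U c : Plane) (hc : 0 < ‖c - U‖) {y : Plane}
    (hy : y ≠ U) :
    1 - expNeg (logLaplace β U z c y) =
      ENNReal.ofReal (1 + 1 / z * (‖y - U‖ / ‖c - U‖) ^ β)⁻¹ := by
  have hyU : 0 < ‖y - U‖ := norm_pos_iff.2 (sub_ne_zero.2 hy)
  have h1 := Real.rpow_pos_of_pos hyU β
  have h2 := Real.rpow_pos_of_pos hc β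
  have hg := gain_nonneg β U y
  rw [logLaplace, expNeg_log (by positivity), ← ENNReal.ofReal_one,
    ← ENNReal.ofReal_sub _ (by positivity), gain, Real.div_rpow hyU.le hc.le]
  congr 1
  field_simp
  ring

lemma w_nonneg (u r θ : ℝ) : 0 ≤ w u r θ := Real.sqrt_nonneg _

lemma rho2Integrand_nonneg (hz : 0 < z) (φ : ℝ) {v : ℝ} (hv : 0 ≤ v) :
    0 ≤ rho2Integrand β z r θ u φ v := by
  have := w_nonneg u v φ
  have := w_nonneg u r θ
  unfold rho2Integrand
  positivity

lemma lintegral_rho2Integrand (hz : 0 < z) (hr : 0 ≤ r) (hw : 0 < w u r θ) :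
    ∫⁻ φ in Ioc 0 (2 * Real.pi), ∫⁻ v in Ioi r, ENNReal.ofReal (rho2Integrand β z r θ u φ v) =
      ∫⁻ y in {y | r < ‖y‖}, (1 - expNeg (logLaplace β !₂[u, 0] z (polarPoint r θ) y)) := by
  have hw' : 0 < ‖polarPoint r θ - !₂[u, 0]‖ := by rwa [norm_polarPoint_sub]
  set U : Plane := !₂[u, 0]
  have hae : ∀ᵐ y : Plane, y ≠ U := by
    simp [ae_iff]
  rw [setLIntegral_congr_fun_ae (g := fun y => ENNReal.ofReal
      (1 + 1 / z * (‖y - U‖ / ‖polarPoint r θ - U‖) ^ β)⁻¹) (measurableSet_lt_norm r)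
      (hae.mono fun y hy _ => one_sub_expNeg_logLaplace hz U _ hw' hy),
    ← lintegral_indicator (measurableSet_lt_norm r),
    lintegral_plane_polar (Measurable.indicator (by fun_prop) (measurableSet_lt_norm r))]
  refine lintegral_congr fun φ => ?_
  have h1 : ∫⁻ v in Ioi r, ENNReal.ofReal (rho2Integrand β z r θ u φ v) =
      ∫⁻ v in Ioi 0, (Ioi r).indicator
        (fun v => ENNReal.ofReal (rho2Integrand β z r θ u φ v)) v := by
    rw [lintegral_indicator measurableSet_Ioi, Measure.restrict_restrict measurableSet_Ioi,
      inter_eq_left.2 (Ioi_subset_Ioi hr)]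
  rw [h1]
  refine setLIntegral_congr_fun measurableSet_Ioi fun v hv => ?_
  have hv : 0 < v := hv
  by_cases hvr : r < v
  · rw [indicator_of_mem (by exact hvr), indicator_of_mem
      (by simpa [norm_polarPoint hv.le] using hvr), ← ENNReal.ofReal_mul hv.le,
      norm_polarPoint_sub, norm_polarPoint_sub, rho2Integrand, mul_comm]
  · rw [indicator_of_notMem (by exact hvr), indicator_of_notMem
      (by simpa [norm_polarPoint hv.le] using hvr), mul_zero]

lemma lintegral_one_sub_expNeg_logLaplace_ne_top (hβ : 2 < β) (hz : 0 ≤ z) (U c : Plane) :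
    ∫⁻ y, (1 - expNeg (logLaplace β U z c y)) ≠ ⊤ := by
  obtain ⟨A, hA⟩ := logLaplace_le (by linarith : 0 ≤ β) U hz c
  refine ne_top_of_le_ne_top ?_ (lintegral_mono fun y => (one_sub_expNeg_le _).trans
    ((min_le_min_left 1 (hA.self_of_nhds y)).trans (min_one_mul_le A _)))
  rw [lintegral_const_mul _ (by fun_prop)]
  exact ENNReal.mul_ne_top (ENNReal.add_ne_top.2 ⟨ENNReal.one_ne_top, ENNReal.coe_ne_top⟩)
    (lintegral_min_gain_ne_top hβ U)

@[fun_prop] lemma measurable_w : Measurable fun p : ℝ × ℝ => w u p.2 p.1 := by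
  unfold w
  fun_prop

lemma measurable_rho2Integrand :
    Measurable fun p : ℝ × ℝ => rho2Integrand β z r θ u p.1 p.2 := by
  unfold rho2Integrand
  exact (((measurable_w.div_const _).pow_const β).const_mul _ |>.const_add 1).inv.mul measurable_snd

lemma integrableOn_rho2Integrand (hβ : 2 < β) (hz : 0 < z) (hr : 0 ≤ r) (hw : 0 < w u r θ) :
    IntegrableOn (fun p : ℝ × ℝ => rho2Integrand β z r θ u p.1 p.2)
      (Ioc 0 (2 * Real.pi) ×ˢ Ioi r) := by
  refine ⟨measurable_rho2Integrand.aestronglyMeasurable, ?_⟩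
  rw [hasFiniteIntegral_iff_ofReal, Measure.volume_eq_prod,
    setLIntegral_prod _ measurable_rho2Integrand.ennreal_ofReal.aemeasurable]
  · simp only
    rw [lintegral_rho2Integrand hz hr hw]
    exact lt_of_le_of_lt (setLIntegral_le_lintegral _ _)
      (lintegral_one_sub_expNeg_logLaplace_ne_top hβ hz.le _ _).lt_top
  · refine (ae_restrict_iff' (measurableSet_Ioc.prod measurableSet_Ioi)).2 (ae_of_all _ ?_)
    rintro ⟨φ, v⟩ ⟨-, hv⟩
    exact rho2Integrand_nonneg hz φ (hr.trans (le_of_lt hv))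

lemma ofReal_rho2 (hlam : 0 < lam) (hβ : 2 < β) (hz : 0 < z) (hr : 0 ≤ r) (hw : 0 < w u r θ) :
    ENNReal.ofReal (rho2 lam β z r θ u) = expNeg (ENNReal.ofReal lam *
      ∫⁻ y in {y | r < ‖y‖}, (1 - expNeg (logLaplace β !₂[u, 0] z (polarPoint r θ) y))) := by
  have hi := integrableOn_rho2Integrand hβ hz hr hw
  have hnn : 0 ≤ᵐ[volume.restrict (Ioc 0 (2 * Real.pi) ×ˢ Ioi r)]
      fun p : ℝ × ℝ => rho2Integrand β z r θ u p.1 p.2 := by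
    refine (ae_restrict_iff' (measurableSet_Ioc.prod measurableSet_Ioi)).2 (ae_of_all _ ?_)
    rintro ⟨φ, v⟩ ⟨-, hv⟩
    exact rho2Integrand_nonneg hz φ (hr.trans (le_of_lt hv))
  have h1 : ∫ φ in (0 : ℝ)..(2 * Real.pi), ∫ v in Ioi r, rho2Integrand β z r θ u φ v =
      ∫ p in Ioc 0 (2 * Real.pi) ×ˢ Ioi r, rho2Integrand β z r θ u p.1 p.2 := by
    rw [intervalIntegral.integral_of_le Real.two_pi_pos.le, Measure.volume_eq_prod,
      setIntegral_prod _ hi]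
  have h2 := ofReal_integral_eq_lintegral_ofReal hi hnn
  rw [Measure.volume_eq_prod, setLIntegral_prod _
    measurable_rho2Integrand.ennreal_ofReal.aemeasurable] at h2
  simp only at h2
  rw [lintegral_rho2Integrand hz hr hw] at h2
  rw [← h2, ← Measure.volume_eq_prod, ← ENNReal.ofReal_mul hlam.le, expNeg_ofReal, rho2, h1, neg_mul]
  exact mul_nonneg hlam.le (integral_nonneg_of_ae hnn)

lemma ofReal_tau2Integrand (hlam : 0 < lam) (hβ : 2 < β) (hz : 0 < z) (hr : 0 ≤ r)
    (hw : 0 < w u r θ) :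
    ENNReal.ofReal (tau2Integrand lam σ β u θ r z) = ENNReal.ofReal r *
      (ENNReal.ofReal (1 + z)⁻¹ * (noiseFactor σ β !₂[u, 0] z (polarPoint r θ) *
        voidLaplace lam ‖polarPoint r θ‖ (logLaplace β !₂[u, 0] z (polarPoint r θ)))) := by
  have hρ : 0 ≤ rho2 lam β z r θ u := (Real.exp_pos _).le
  have hwb : 0 ≤ w u r θ ^ β := Real.rpow_nonneg (w_nonneg _ _ _) _
  rw [norm_polarPoint hr, voidLaplace_eq, ← ofReal_rho2 hlam hβ hz hr hw, voidLaplace_zero hlam hr,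
    noiseFactor, norm_polarPoint_sub, expNeg_ofReal (by positivity),
    ← ENNReal.ofReal_mul (by positivity), ← ENNReal.ofReal_mul (by positivity),
    ← ENNReal.ofReal_mul (by positivity), ← ENNReal.ofReal_mul (by positivity), tau2Integrand]
  congr 1
  rw [show -lam * Real.pi * r ^ 2 - σ ^ 2 * w u r θ ^ β * z =
    -(σ ^ 2 * w u r θ ^ β * z) + -(lam * Real.pi * r ^ 2) by ring, Real.exp_add]
  field_simp

/-- The serving station can coincide with the user only for r = |u|, a null set of radii, so the
condition w > 0 costs nothing under the integral. -/
lemma w_pos_of_ne (hr : 0 ≤ r) (hne : r ≠ |u|) : 0 < w u r θ := by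
  rw [← norm_polarPoint_sub, norm_pos_iff, sub_ne_zero]
  intro h
  refine hne ?_
  rw [← norm_polarPoint hr θ, h, EuclideanSpace.norm_eq, Fin.sum_univ_two]
  simp [Real.sqrt_sq_eq_abs]

end Rho

/-! ### The rate density and its finite mass -/

/-- Density of the coverage probability at threshold `z`, divided by `1 + z`, with respect to the
position `x` of the serving base station. -/
noncomputable def rateDensity (lam σ β : ℝ) (U : Plane) (x : Plane) (z : ℝ) : ℝ≥0∞ :=
  ENNReal.ofReal (1 + z)⁻¹ *
    (noiseFactor σ β U z x * voidLaplace lam ‖x‖ (logLaplace β U z x))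

lemma measurable_rateDensity (lam σ β : ℝ) (U : Plane) :
    Measurable fun p : Plane × ℝ => rateDensity lam σ β U p.1 p.2 := by
  unfold rateDensity
  refine Measurable.mul (by fun_prop) (Measurable.mul ?_ ?_)
  · unfold noiseFactor
    fun_prop
  · unfold voidLaplace
    refine measurable_expNeg.comp (Measurable.const_mul ?_ _)
    have hk : Measurable fun q : (Plane × ℝ) × Plane =>
        killDisk ‖q.1.1‖ (logLaplace β U q.1.2 q.1.1) q.2 := by
      unfold killDisk
      refine Measurable.ite (measurableSet_le (by fun_prop) (by fun_prop)) measurable_const ?_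
      unfold logLaplace
      have hg : Measurable fun q : (Plane × ℝ) × Plane => gain β U q.2 :=
        (measurable_gain β U).comp measurable_snd
      fun_prop
    exact Measurable.lintegral_prod_right' (f := fun q : (Plane × ℝ) × Plane =>
      1 - expNeg (killDisk ‖q.1.1‖ (logLaplace β U q.1.2 q.1.1) q.2))
      (measurable_const.sub (measurable_expNeg.comp hk))

lemma lintegral_coverage_eq (lam σ β : ℝ) (U : Plane) :
    ∫⁻ z in Ioi 0, ENNReal.ofReal (1 + z)⁻¹ * (ENNReal.ofReal lam *
        ∫⁻ x, noiseFactor σ β U z x * voidLaplace lam ‖x‖ (logLaplace β U z x)) =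
      ENNReal.ofReal lam * ∫⁻ x, ∫⁻ z in Ioi 0, rateDensity lam σ β U x z := by
  rw [lintegral_lintegral_swap (measurable_rateDensity lam σ β U).aemeasurable,
    ← lintegral_const_mul' _ _ ENNReal.ofReal_ne_top]
  refine lintegral_congr fun z => ?_
  simp only [rateDensity]
  rw [lintegral_const_mul' _ _ ENNReal.ofReal_ne_top, mul_left_comm]

lemma lintegral_rateDensity_eq {lam : ℝ} (hlam : 0 < lam) (σ : ℝ) {β : ℝ} (hβ : 2 < β) (u : ℝ) :
    ∫⁻ x, ∫⁻ z in Ioi 0, rateDensity lam σ β !₂[u, 0] x z =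
      ∫⁻ θ in Ioc 0 (2 * Real.pi), ∫⁻ r in Ioi 0, ∫⁻ z in Ioi 0,
        ENNReal.ofReal (tau2Integrand lam σ β u θ r z) := by
  rw [lintegral_plane_polar (measurable_rateDensity lam σ β _).lintegral_prod_right']
  refine lintegral_congr fun θ => setLIntegral_congr_fun_ae measurableSet_Ioi ?_
  have hae : ∀ᵐ r : ℝ, r ≠ |u| := by simp [ae_iff]
  filter_upwards [hae] with r hne hr
  have hr : 0 < r := hr
  rw [← lintegral_const_mul' _ _ ENNReal.ofReal_ne_top]
  refine setLIntegral_congr_fun measurableSet_Ioi fun z hz => ?_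
  exact (ofReal_tau2Integrand hlam hβ hz hr.le (w_pos_of_ne hr.le hne)).symm

/-- The exponent -1/β bounds the noise factor by a constant times z^(-1/β)/‖x - U‖. The z-integral
then converges because 0 < 1/β < 1. In x, the pole is integrable on the unit disk around U; outside
that disk 1/‖x - U‖ ≤ 1 and the void probability is a Gaussian. -/
lemma lintegral_rateDensity_ne_top {lam : ℝ} (hlam : 0 < lam) {σ : ℝ} (hσ : 0 < σ ^ 2) {β : ℝ}
    (hβ : 2 < β) (U : Plane) :
    ∫⁻ x, ∫⁻ z in Ioi 0, rateDensity lam σ β U x z ≠ ⊤ := by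
  have hβ0 : 0 < β := by linarith
  have ha0 : 0 < β⁻¹ := inv_pos.2 hβ0
  have ha1 : β⁻¹ < 1 := inv_lt_one_of_one_lt₀ (by linarith)
  set M := ∫⁻ z in Ioi (0 : ℝ), ENNReal.ofReal ((1 + z)⁻¹ * z ^ (-β⁻¹)) with hM
  set K := ENNReal.ofReal ((σ ^ 2) ^ (-β⁻¹)) with hK
  have hmv : Measurable fun x : Plane => voidLaplace lam ‖x‖ 0 := by
    simp only [voidLaplace_zero hlam (norm_nonneg _)]
    fun_prop
  have hle : ∀ᵐ x : Plane, ∫⁻ z in Ioi 0, rateDensity lam σ β U x z ≤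
      M * K * (voidLaplace lam ‖x‖ 0 +
        (Metric.ball U 1).indicator (fun x => ENNReal.ofReal ‖x - U‖⁻¹) x) := by
    have hae : ∀ᵐ x : Plane, x ≠ U := by simp [ae_iff]
    filter_upwards [hae] with x hx
    have hxU : 0 < ‖x - U‖ := norm_pos_iff.2 (sub_ne_zero.2 hx)
    have hv1 : voidLaplace lam ‖x‖ 0 ≤ 1 := expNeg_le_one _
    calc _ ≤ ∫⁻ z in Ioi (0 : ℝ), ENNReal.ofReal ((1 + z)⁻¹ * z ^ (-β⁻¹)) *
          (K * ENNReal.ofReal ‖x - U‖⁻¹ * voidLaplace lam ‖x‖ 0) := by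
          refine setLIntegral_mono' measurableSet_Ioi fun z hz => ?_
          have hz : 0 < z := hz
          have hwb := Real.rpow_pos_of_pos hxU β
          have hn : noiseFactor σ β U z x ≤
              ENNReal.ofReal (z ^ (-β⁻¹)) * (K * ENNReal.ofReal ‖x - U‖⁻¹) := by
            rw [noiseFactor, expNeg_ofReal (by positivity), hK, ← ENNReal.ofReal_mul (by positivity),
              ← ENNReal.ofReal_mul (by positivity)]
            refine ENNReal.ofReal_le_ofReal ((exp_neg_le_rpow ha0 ha1 (by positivity)).trans_eq ?_)
            rw [Real.mul_rpow (by positivity) hz.le, Real.mul_rpow hσ.le hwb.le,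
              ← Real.rpow_mul hxU.le, mul_neg, mul_inv_cancel₀ hβ0.ne', Real.rpow_neg_one]
            ring
          calc rateDensity lam σ β U x z ≤ ENNReal.ofReal (1 + z)⁻¹ *
                ((ENNReal.ofReal (z ^ (-β⁻¹)) * (K * ENNReal.ofReal ‖x - U‖⁻¹)) *
                  voidLaplace lam ‖x‖ 0) := by
                unfold rateDensity
                gcongr
                exact voidLaplace_le _ _ _
            _ = _ := by
                rw [ENNReal.ofReal_mul (by positivity)]
                ring
      _ = M * K * (ENNReal.ofReal ‖x - U‖⁻¹ * voidLaplace lam ‖x‖ 0) := by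
          rw [lintegral_mul_const _ (by fun_prop)]
          ring
      _ ≤ _ := by
          gcongr
          by_cases h : ‖x - U‖ < 1
          · rw [indicator_of_mem (by simpa [dist_eq_norm] using h)]
            exact (mul_le_of_le_one_right zero_le hv1).trans le_add_self
          · refine le_trans (mul_le_of_le_one_left zero_le ?_) le_self_add
            rw [ENNReal.ofReal_le_one]
            exact inv_le_one_of_one_le₀ (not_lt.1 h)
  refine ne_top_of_le_ne_top ?_ (lintegral_mono_ae hle)
  have hMK : M * K ≠ ⊤ :=
    ENNReal.mul_ne_top (lintegral_Ioi_rpow_div_ne_top ha0 ha1) ENNReal.ofReal_ne_top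
  rw [lintegral_const_mul' _ _ hMK, lintegral_add_left hmv, lintegral_indicator measurableSet_ball]
  refine ENNReal.mul_ne_top hMK (ENNReal.add_ne_top.2 ⟨?_, lintegral_inv_norm_ball_ne_top U⟩)
  have h := lintegral_voidLaplace_zero hlam
  intro h'
  rw [h', ENNReal.mul_top (by simpa using hlam)] at h
  exact ENNReal.top_ne_one h

/-! ### Convergence and evaluation of τ₂ -/

section Tau

variable {lam σ β u : ℝ}

lemma measurable_rho2 : Measurable fun p : ℝ × ℝ × ℝ => rho2 lam β p.2.2 p.2.1 p.1 u := by
  -- The domain v > r moves with the parameter; an indicator makes the integrand jointly measurable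
  -- on a fixed domain.
  have h1 : ∀ p : ℝ × ℝ × ℝ, rho2 lam β p.2.2 p.2.1 p.1 u = Real.exp (-lam *
      ∫ φ in Ioc 0 (2 * Real.pi), ∫ v, {q : ((ℝ × ℝ × ℝ) × ℝ) × ℝ | q.1.1.2.1 < q.2}.indicator
        (fun q => rho2Integrand β q.1.1.2.2 q.1.1.2.1 q.1.1.1 u q.1.2 q.2) ((p, φ), v)) := by
    intro p
    rw [rho2, intervalIntegral.integral_of_le Real.two_pi_pos.le]
    congr 2
    refine integral_congr_ae (ae_of_all _ fun φ => ?_)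
    simp only
    rw [← integral_indicator measurableSet_Ioi]
    rfl
  simp only [h1]
  have hm : Measurable ({q : ((ℝ × ℝ × ℝ) × ℝ) × ℝ | q.1.1.2.1 < q.2}.indicator
        (fun q => rho2Integrand β q.1.1.2.2 q.1.1.2.1 q.1.1.1 u q.1.2 q.2)) := by
    refine Measurable.indicator ?_ (measurableSet_lt (by fun_prop) (by fun_prop))
    unfold rho2Integrand w
    fun_prop
  exact Real.measurable_exp.comp
    ((hm.stronglyMeasurable.integral_prod_right'.integral_prod_right').measurable.const_mul _)

lemma measurable_tau2Integrand :
    Measurable fun p : ℝ × ℝ × ℝ => tau2Integrand lam σ β u p.1 p.2.1 p.2.2 := by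
  have h := measurable_rho2 (lam := lam) (β := β) (u := u)
  unfold tau2Integrand w
  fun_prop

lemma tau2Integrand_nonneg (θ : ℝ) {r z : ℝ} (hr : 0 ≤ r) (hz : 0 ≤ z) :
    0 ≤ tau2Integrand lam σ β u θ r z := by
  have : 0 ≤ rho2 lam β z r θ u := (Real.exp_pos _).le
  unfold tau2Integrand
  positivity

lemma lintegral_prod_tau2Integrand :
    ∫⁻ p in Ioc 0 (2 * Real.pi) ×ˢ Ioi 0 ×ˢ Ioi 0,
        ENNReal.ofReal (tau2Integrand lam σ β u p.1 p.2.1 p.2.2) =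
      ∫⁻ θ in Ioc 0 (2 * Real.pi), ∫⁻ r in Ioi 0, ∫⁻ z in Ioi 0,
        ENNReal.ofReal (tau2Integrand lam σ β u θ r z) := by
  have hm := (measurable_tau2Integrand (lam := lam) (σ := σ) (β := β) (u := u)).ennreal_ofReal
  rw [Measure.volume_eq_prod, setLIntegral_prod _ hm.aemeasurable]
  refine lintegral_congr fun θ => ?_
  have hmθ : Measurable fun q : ℝ × ℝ => ENNReal.ofReal (tau2Integrand lam σ β u θ q.1 q.2) :=
    hm.comp measurable_prodMk_left
  exact setLIntegral_prod _ hmθ.aemeasurable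

lemma integrableOn_tau2Integrand (hlam : 0 < lam) (hσ : 0 < σ ^ 2) (hβ : 2 < β) :
    IntegrableOn (fun p : ℝ × ℝ × ℝ => tau2Integrand lam σ β u p.1 p.2.1 p.2.2)
      (Ioc 0 (2 * Real.pi) ×ˢ Ioi 0 ×ˢ Ioi 0) := by
  refine ⟨measurable_tau2Integrand.aestronglyMeasurable, ?_⟩
  rw [hasFiniteIntegral_iff_ofReal, lintegral_prod_tau2Integrand,
    ← lintegral_rateDensity_eq hlam σ hβ]
  · exact (lintegral_rateDensity_ne_top hlam hσ hβ _).lt_top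
  · refine (ae_restrict_iff' (measurableSet_Ioc.prod (measurableSet_Ioi.prod
      measurableSet_Ioi))).2 (ae_of_all _ ?_)
    rintro ⟨θ, r, z⟩ ⟨-, hr, hz⟩
    exact tau2Integrand_nonneg θ (le_of_lt hr) (le_of_lt hz)

lemma tau2_nonneg (hlam : 0 < lam) : 0 ≤ tau2 lam σ β u := by
  refine mul_nonneg hlam.le (intervalIntegral.integral_nonneg Real.two_pi_pos.le fun θ _ => ?_)
  exact setIntegral_nonneg measurableSet_Ioi fun r hr =>
    setIntegral_nonneg measurableSet_Ioi fun z hz =>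
      tau2Integrand_nonneg θ (le_of_lt hr) (le_of_lt hz)

lemma ofReal_tau2 (hlam : 0 < lam) (hσ : 0 < σ ^ 2) (hβ : 2 < β) :
    ENNReal.ofReal (tau2 lam σ β u) =
      ENNReal.ofReal lam * ∫⁻ x, ∫⁻ z in Ioi 0, rateDensity lam σ β !₂[u, 0] x z := by
  have hi := integrableOn_tau2Integrand (u := u) hlam hσ hβ
  have hnn : 0 ≤ᵐ[volume.restrict (Ioc 0 (2 * Real.pi) ×ˢ Ioi 0 ×ˢ Ioi 0)]
      fun p : ℝ × ℝ × ℝ => tau2Integrand lam σ β u p.1 p.2.1 p.2.2 := by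
    refine (ae_restrict_iff' (measurableSet_Ioc.prod (measurableSet_Ioi.prod
      measurableSet_Ioi))).2 (ae_of_all _ ?_)
    rintro ⟨θ, r, z⟩ ⟨-, hr, hz⟩
    exact tau2Integrand_nonneg θ (le_of_lt hr) (le_of_lt hz)
  rw [lintegral_rateDensity_eq hlam σ hβ, ← lintegral_prod_tau2Integrand,
    ← ofReal_integral_eq_lintegral_ofReal hi hnn, ← ENNReal.ofReal_mul hlam.le, tau2,
    intervalIntegral.integral_of_le Real.two_pi_pos.le]
  congr 2
  rw [Measure.volume_eq_prod, setIntegral_prod _ hi]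
  -- Integrability on the product gives integrable slices for almost every θ, which justifies
  -- splitting the inner integral over (r, z).
  have hi' : Integrable (fun p : ℝ × ℝ × ℝ => tau2Integrand lam σ β u p.1 p.2.1 p.2.2)
      ((volume.restrict (Ioc 0 (2 * Real.pi))).prod (volume.restrict (Ioi 0 ×ˢ Ioi 0))) := by
    rw [Measure.prod_restrict]
    exact hi
  refine integral_congr_ae ?_
  filter_upwards [hi'.prod_right_ae] with θ hθ
  rw [Measure.volume_eq_prod, setIntegral_prod _ hθ]

end Tau

/-! ### Expected rate at a single time -/

section Fading

variable {Ω : Type*} [MeasurableSpace Ω] {P : Measure Ω} {X : ℕ → Ω → Plane} {H : ℕ → ℕ → Ω → ℝ}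

lemma IsRayleighFading.iIndepFun_time (hH : IsRayleighFading P X H) (t : ℕ) :
    iIndepFun (fun j ω => H j t ω) P :=
  hH.indep.precomp (g := fun j => (j, t)) fun _ _ h => (Prod.mk.inj h).1

lemma IsRayleighFading.indepFun_time (hH : IsRayleighFading P X H) (t : ℕ) :
    IndepFun (fun ω i => X i ω) (fun ω j => H j t ω) P :=
  hH.indep_points.comp (φ := id) (ψ := fun (g : ℕ × ℕ → ℝ) (j : ℕ) => g (j, t)) measurable_id
    (measurable_pi_lambda _ fun j => measurable_pi_apply (j, t))

variable {lam σ β : ℝ}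

lemma ae_rate_nonneg (hH : IsRayleighFading P X H) (u : Plane) (t : ℕ) :
    0 ≤ᵐ[P] fun ω => Real.log (1 + sinr σ β (fun i => X i ω) (fun j => H j t ω) u
      (nearestIndex fun i => X i ω)) := by
  filter_upwards [ae_nonneg_of_hasLaw fun j => hH.law j t] with ω hω
  have h := sinr_nonneg (σ := σ) (β := β) (u := u) (x := fun i => X i ω)
    (h := fun j => H j t ω) hω (nearestIndex fun i => X i ω)
  exact Real.log_nonneg (by linarith)

variable [IsProbabilityMeasure P]

lemma aemeasurable_rate (hX : IsHomogeneousPPP P lam X) (hH : IsRayleighFading P X H)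
    (hlam : 0 < lam) (hβ : 2 < β) (u : Plane) (t : ℕ) :
    AEMeasurable (fun ω => Real.log (1 + sinr σ β (fun i => X i ω) (fun j => H j t ω) u
      (nearestIndex fun i => X i ω))) P := by
  classical
  have hXm : Measurable fun ω i => X i ω := measurable_pi_lambda _ hX.measurable
  have hHm : Measurable fun ω j => H j t ω := measurable_pi_lambda _ fun j => hH.measurable j t
  have hn : Measurable fun ω => nearestIndex fun i => X i ω := measurable_nearestIndex.comp hXm
  have hXb : Measurable fun ω => X (nearestIndex fun i => X i ω) ω :=
    measurable_eval_nearestIndex.comp (hXm.prodMk hXm)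
  have hHb : Measurable fun ω => H (nearestIndex fun i => X i ω) t ω :=
    measurable_eval_nearestIndex.comp (hXm.prodMk hHm)
  have hI : Measurable fun ω => ∑' j, if j = nearestIndex fun i => X i ω then (0 : ℝ≥0∞) else
      ENNReal.ofReal (gain β u (X j ω) * H j t ω) := by
    refine Measurable.tsum fun j => Measurable.ite (measurableSet_eq_fun measurable_const hn)
      measurable_const ?_
    exact (((measurable_gain β u).comp (hX.measurable j)).mul (hH.measurable j t)).ennreal_ofReal
  have hw : Measurable fun ω => ‖X (nearestIndex fun i => X i ω) ω - u‖ ^ (-β) :=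
    (hXb.sub_const u).norm.pow_const _
  -- The measurable version uses the [0, ∞]-valued interference; it agrees with the real series
  -- wherever that converges, hence almost surely.
  refine ⟨fun ω => Real.log (1 + H (nearestIndex fun i => X i ω) t ω *
    ‖X (nearestIndex fun i => X i ω) ω - u‖ ^ (-β) / (σ ^ 2 +
      (∑' j, if j = nearestIndex fun i => X i ω then (0 : ℝ≥0∞) else
        ENNReal.ofReal (gain β u (X j ω) * H j t ω)).toReal)), ?_, ?_⟩
  · exact Real.measurable_log.comp (((hHb.mul hw).div (hI.ennreal_toReal.const_add _)).const_add _)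
  · filter_upwards [ae_nonneg_of_hasLaw fun j => hH.law j t,
      ae_tsum_gain_mul_ne_top hlam hX (fun j => hH.measurable j t) (fun j => hH.law j t)
        (hH.indepFun_time t) hβ u] with ω h1 h2
    rw [sinr, tsum_ite_eq_ofReal_interference (x := fun i => X i ω) (h := fun j => H j t ω) h1 h2,
      ENNReal.toReal_ofReal (interference_nonneg h1 _)]

lemma lintegral_rate_eq_tau2 (hlam : 0 < lam) (hσ : 0 < σ ^ 2) (hβ : 2 < β)
    (hX : IsHomogeneousPPP P lam X) (hH : IsRayleighFading P X H) (u : ℝ) (t : ℕ) :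
    ∫⁻ ω, ENNReal.ofReal (Real.log (1 + sinr σ β (fun i => X i ω) (fun j => H j t ω) !₂[u, 0]
      (nearestIndex fun i => X i ω))) ∂P = ENNReal.ofReal (tau2 lam σ β u) := by
  rw [ofReal_tau2 hlam hσ hβ, ← lintegral_coverage_eq]
  exact lintegral_rate hlam hX (fun j => hH.measurable j t) (fun j => hH.law j t)
    (hH.iIndepFun_time t) (hH.indepFun_time t) hσ hβ _

lemma integrable_rate (hlam : 0 < lam) (hσ : 0 < σ ^ 2) (hβ : 2 < β)
    (hX : IsHomogeneousPPP P lam X) (hH : IsRayleighFading P X H) (u : ℝ) (t : ℕ) :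
    Integrable (fun ω => Real.log (1 + sinr σ β (fun i => X i ω) (fun j => H j t ω) !₂[u, 0]
      (nearestIndex fun i => X i ω))) P := by
  refine ⟨(aemeasurable_rate hX hH hlam hβ _ t).aestronglyMeasurable, ?_⟩
  rw [hasFiniteIntegral_iff_ofReal (ae_rate_nonneg hH _ t),
    lintegral_rate_eq_tau2 hlam hσ hβ hX hH]
  exact ENNReal.ofReal_lt_top

lemma integral_rate (hlam : 0 < lam) (hσ : 0 < σ ^ 2) (hβ : 2 < β)
    (hX : IsHomogeneousPPP P lam X) (hH : IsRayleighFading P X H) (u : ℝ) (t : ℕ) :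
    ∫ ω, Real.log (1 + sinr σ β (fun i => X i ω) (fun j => H j t ω) !₂[u, 0]
      (nearestIndex fun i => X i ω)) ∂P = tau2 lam σ β u := by
  rw [integral_eq_lintegral_of_nonneg_ae (ae_rate_nonneg hH _ t)
    (aemeasurable_rate hX hH hlam hβ _ t).aestronglyMeasurable,
    lintegral_rate_eq_tau2 hlam hσ hβ hX hH, ENNReal.toReal_ofReal (tau2_nonneg hlam)]

end Fading

end HandoverSkipping

theorem theorem2 {Ω : Type*} [MeasurableSpace Ω] (P : Measure Ω) [IsProbabilityMeasure P]
    (X : ℕ → Ω → Plane) (H : ℕ → ℕ → Ω → ℝ) (lam σ β l : ℝ) (s : ℕ)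
    (hlam : 0 < lam) (hσ : 0 < σ ^ 2) (hβ : 2 < β) (hl : 0 ≤ l) (hs : 0 < s)
    (hX : IsHomogeneousPPP P lam X) (hH : IsRayleighFading P X H) :
    -- the interference sums converge almost surely
    (∀ t < s, ∀ᵐ ω ∂P, Summable (fun j : {j : ℕ // j ≠ nearestIndex (fun i => X i ω)} =>
      H j t ω / ‖X j ω - uePosition s l t‖ ^ β)) ∧
    -- the amount of received data has a finite expectation
    Integrable (fun ω => receivedData σ β s l (fun i => X i ω) (fun i t => H i t ω)) P ∧
    -- the integrals in the formula converge
    (∀ t < s, ∀ z > 0, ∀ r > 0, ∀ θ : ℝ, 0 < w (l * t / s) r θ →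
      IntegrableOn (fun p : ℝ × ℝ => rho2Integrand β z r θ (l * t / s) p.1 p.2)
        (Ioc 0 (2 * Real.pi) ×ˢ Ioi r)) ∧
    (∀ t < s, IntegrableOn
      (fun p : ℝ × ℝ × ℝ => tau2Integrand lam σ β (l * t / s) p.1 p.2.1 p.2.2)
      (Ioc 0 (2 * Real.pi) ×ˢ Ioi 0 ×ˢ Ioi 0)) ∧
    -- the formula
    expectedData P X H σ β s l = ∑ t ∈ Finset.range s, tau2 lam σ β (l * t / s) := by

  refine ⟨fun t _ => ?_, ?_, fun t _ z hz r hr θ hw => integrableOn_rho2Integrand hβ hz hr.le hw,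
    fun t _ => integrableOn_tau2Integrand hlam hσ hβ, ?_⟩
  · filter_upwards [ae_nonneg_of_hasLaw fun j => hH.law j t,
      ae_tsum_gain_mul_ne_top hlam hX (fun j => hH.measurable j t) (fun j => hH.law j t)
        (hH.indepFun_time t) hβ (uePosition s l t)] with ω h1 h2
    exact (summable_gain_mul (x := fun i => X i ω) (h := fun j => H j t ω) h1 h2).subtype _
  -- `uePosition s l t` unfolds to `!₂[l * t / s, 0]`, so the single-time results apply to each
  -- summand.
  · exact integrable_finsetSum _ fun t _ => integrable_rate hlam hσ hβ hX hH _ t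
  · have hi : ∀ t ∈ Finset.range s, Integrable (fun ω =>
        skippingRate σ β s l (fun i => X i ω) (fun i t => H i t ω) t) P :=
      fun t _ => integrable_rate hlam hσ hβ hX hH _ t
    unfold expectedData receivedData
    rw [integral_finsetSum _ hi]
    exact Finset.sum_congr rfl fun t _ => integral_rate hlam hσ hβ hX hH _ t
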